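/- Let $d\ge 1$, let $E\subset\mathbb{R}^d$ and $\Gamma\subset\mathbb{R}^d\times\mathbb{R}_{>0}$ be non-empty Borel sets, where $\Gamma$ need not be a product set, and put $$\Gamma(E)=\{\,rx+z:\ x\in E,\ (z,r)\in\Gamma\,\}.$$ For a compactly supported Borel probability measure $\mu$ on $\mathbb{R}^d$ let $\widehat\mu(\xi)=\int e^{-2\pi i\xi\cdot x}\,d\mu(x)$ and $$\dim_{\mathcal S}\mu=\sup\Big\{s\in\mathbb{R}:\ \int_{\mathbb{R}^d}|\widehat\mu(\xi)|^2(1+|\xi|)^{s-d}\,d\xi<\infty\Big\},$$ and for $A\subset\mathbb{R}^d$ let the Sobolev dimension $\dim_{\mathcal S}A\in[-\infty,\infty]$ be the supremum of $\dim_{\mathcal S}\mu$ over all Borel probability measures $\mu$ with compact support contained in $A$. Let $\dim_{\mathcal H}$ denote Hausdorff dimension and $\mathcal{L}^d$ Lebesgue (outer) measure. Then: (i) $\dim_{\mathcal S}\Gamma(E)\ \ge\ \dim_{\mathcal H}E+\dim_{\mathcal H}\Gamma-d$. (ii) If $\dim_{\mathcal H}E+\dim_{\mathcal H}\Gamma>2d$,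 then $\mathcal{L}^d(\Gamma(E))>0$. (iii) If $0<u<d$ and $\dim_{\mathcal H}E+\dim_{\mathcal H}\Gamma>d+u$, then $\dim_{\mathcal H}\Gamma(E)\ge u$. -/

import Mathlib

open MeasureTheory

noncomputable section

/-- The set `Γ(d) = ℝ^d × ℝ_{>0}` of all pairs `γ = (z, r)` (translation, dilation), as a subset of
`ℝ^d × ℝ`. -/
def dilationTranslations (d : ℕ) : Set (EuclideanSpace ℝ (Fin d) × ℝ) :=
  {γ | 0 < γ.2}

/-- The action `γ(x) = r x + z` of `γ = (z, r)` on `ℝ^d`. -/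
def dilateTranslate {d : ℕ} (γ : EuclideanSpace ℝ (Fin d) × ℝ) (x : EuclideanSpace ℝ (Fin d)) :
    EuclideanSpace ℝ (Fin d) :=
  γ.2 • x + γ.1

/-- `Γ(E) = {γ(x) : x ∈ E, γ ∈ Γ}`. -/
def dilateTranslateSet {d : ℕ} (Γ : Set (EuclideanSpace ℝ (Fin d) × ℝ))
    (E : Set (EuclideanSpace ℝ (Fin d))) : Set (EuclideanSpace ℝ (Fin d)) :=
  {y | ∃ γ ∈ Γ, ∃ x ∈ E, y = dilateTranslate γ x}

/-- The Fourier transform `ξ ↦ ∫ e^{-2π i ξ·x} dμ(x)` of a measure on `ℝ^d`. -/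
def measureFourier {d : ℕ} (μ : Measure (EuclideanSpace ℝ (Fin d)))
    (ξ : EuclideanSpace ℝ (Fin d)) : ℂ :=
  ∫ x, Complex.exp (-2 * Real.pi * Complex.I * (inner ℝ ξ x : ℝ)) ∂μ

/-- The integral `∫ |μ̂(ξ)|² (1 + |ξ|)^{s-d} dξ`, with values in `[0, ∞]`. -/
def sobolevIntegral {d : ℕ} (μ : Measure (EuclideanSpace ℝ (Fin d))) (s : ℝ) : ENNReal :=
  ∫⁻ ξ, ENNReal.ofReal (‖measureFourier μ ξ‖ ^ 2 * (1 + ‖ξ‖) ^ (s - d))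

/-- The Sobolev dimension of a measure: the supremum in `[-∞, ∞]` of all real `s` for which
the integral `sobolevIntegral μ s` is finite. -/
def measureSobolevDim {d : ℕ} (μ : Measure (EuclideanSpace ℝ (Fin d))) : EReal :=
  ⨆ (s : ℝ) (_ : sobolevIntegral μ s < ⊤), (s : EReal)

/-- `μ` is a Borel probability measure with compact support contained in `A`. -/
def IsCarriedBy {d : ℕ} (μ : Measure (EuclideanSpace ℝ (Fin d)))
    (A : Set (EuclideanSpace ℝ (Fin d))) : Prop :=
  IsProbabilityMeasure μ ∧ ∃ K, IsCompact K ∧ K ⊆ A ∧ μ Kᶜ = 0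

/-- The Sobolev dimension of a set: the supremum of the Sobolev dimensions of the compactly
supported Borel probability measures that it carries (`⊥` for the empty set). -/
def sobolevDim {d : ℕ} (A : Set (EuclideanSpace ℝ (Fin d))) : EReal :=
  ⨆ (μ : Measure (EuclideanSpace ℝ (Fin d))) (_ : IsCarriedBy μ A), measureSobolevDim μ

end

/-! By Frostman's lemma, `E` and `Γ` carry compactly supported probability measures `μ` and `ν` with
`μ(B(x,ρ)) ≲ ρ^s` and `ν(B(γ,ρ)) ≲ ρ^t`, where `s` and `t` are as close as desired to the two
Hausdorff dimensions. The measure `σ`, the image of `ν × μ` under `(γ, x) ↦ r x + z`, lives on a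
compact subset of `Γ(E)`. All three assertions follow from the bound `∫_{|ξ| ~ R} |σ̂|² ≲
R^(2d-s-t)` (`exists_setLIntegral_shell_le`).

To prove the bound, write `σ̂(ξ) = ∫ e(-ξ·z) μ̂(rξ) dν(z,r)`. Since `μ` has bounded support, `r ↦
μ̂(rξ)` hardly varies below scale `1/R`, so it is exactly a Gaussian convolution at that scale of a
slightly corrected function. Hence `σ̂(ξ) = ∫ N(ξ,u) M(ξ,u) du`, with `N` depending only on `ν` and
`M` only on `μ`, and Cauchy–Schwarz in `u` separates them. The weighted `L²` norm of `M` is an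
energy of the projection of `μ` to the line of `ξ`. It is controlled by the mass of slabs of width
`1/|ξ|`, about `R^(d-1)` balls of radius `1/R`, which gives `R^(d-1-s)`. The `L²` norm of `N` in
`(ξ,u)` is an energy of `ν` at scale `1/R` in all `d+1` variables, which gives `R^(d+1-t)`. No
product structure of `Γ` enters.

Summing over dyadic shells, `∫ |σ̂|² (1+|ξ|)^(a-d) < ∞` whenever `a < s+t-d`, which is (i). With `a
= d` the transform is square integrable, and a measure with this property cannot live on a compact
null set: (ii). With `u < a ≤ d` one gets averaged bounds on the mass of balls, and the mass
distribution principle gives (iii).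

Frostman's lemma for Borel sets is proved on binary sequences: the dyadic content is continuous
along increasing unions, hence an analytic set of positive content contains a compact one, and on a
compact set mass is distributed down the tree. -/

open MeasureTheory Set Filter Topology
open scoped ENNReal

noncomputable section

/-! ### Contents on sequence space and their continuity from below. -/

namespace CylinderContent

variable {S : Type*}

/-- The first `k` digits of the sequence `x`, the most recent digit first. -/
def initial (x : ℕ → S) : ℕ → List S
  | 0 => []
  | k + 1 => x k :: initial x k

/-- The cylinder of all sequences whose initial digits are given by `l`. -/
def wordCylinder (l : List S) : Set (ℕ → S) := {x | initial x l.length = l}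

@[simp] lemma length_initial (x : ℕ → S) (k : ℕ) : (initial x k).length = k := by
  induction k with
  | zero => rfl
  | succ k ih => simp [initial, ih]

lemma mem_cylinder_initial (x : ℕ → S) (k : ℕ) : x ∈ wordCylinder (initial x k) := by
  simp [wordCylinder]

lemma mem_cylinder_cons {x : ℕ → S} {a : S} {l : List S} :
    x ∈ wordCylinder (a :: l) ↔ x l.length = a ∧ x ∈ wordCylinder l := by
  simp [wordCylinder, initial]

lemma cylinder_nil : wordCylinder ([] : List S) = univ := by
  ext x; simp [wordCylinder, initial]

lemma cylinder_eq_iUnion_cons (l : List S) : wordCylinder l = ⋃ a, wordCylinder (a :: l) := by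
  ext x; simp [mem_cylinder_cons]

lemma initial_suffix_initial (x : ℕ → S) {j k : ℕ} (h : j ≤ k) : initial x j <:+ initial x k := by
  induction h with
  | refl => exact List.suffix_refl _
  | step _ ih => exact ih.trans (List.suffix_cons _ _)

lemma eq_initial_of_suffix {x : ℕ → S} {k : ℕ} {t : List S} (h : t <:+ initial x k) :
    t = initial x t.length := by
  have hk : t.length ≤ k := by simpa using h.length_le
  have h' := initial_suffix_initial x hk
  have := List.suffix_of_suffix_length_le h h' (by simp)
  exact this.eq_of_length (by simp)

lemma cylinder_subset_of_suffix {t l : List S} (h : t <:+ l) : wordCylinder l ⊆ wordCylinder t := by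
  intro x hx
  have hx' : initial x l.length = l := hx
  rw [← hx'] at h
  exact (eq_initial_of_suffix h).symm

lemma suffix_or_suffix_of_mem {x : ℕ → S} {l t : List S} (hl : x ∈ wordCylinder l)
    (ht : x ∈ wordCylinder t) : l <:+ t ∨ t <:+ l := by
  have hl' : initial x l.length = l := hl
  have ht' : initial x t.length = t := ht
  rcases le_total l.length t.length with h | h
  · left; rw [← hl', ← ht']; exact initial_suffix_initial x h
  · right; rw [← hl', ← ht']; exact initial_suffix_initial x h

/-- The union of the cylinders given by a set of words. -/
def covered (C : Set (List S)) : Set (ℕ → S) := ⋃ c ∈ C, wordCylinder c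

lemma mem_covered {C : Set (List S)} {x : ℕ → S} : x ∈ covered C ↔ ∃ c ∈ C, x ∈ wordCylinder c := by
  simp [covered]

/-- The words of `C` whose cylinder is maximal. -/
def maximalWords (C : Set (List S)) : Set (List S) := {c ∈ C | ∀ t ∈ C, t <:+ c → t = c}

/-- A sequence lying in some cylinder of `C` also lies in the one given by its shortest initial word
in `C`, and that word is maximal. -/
lemma covered_maximalWords (C : Set (List S)) : covered (maximalWords C) = covered C := by
  classical
  ext x
  simp only [mem_covered]
  constructor
  · rintro ⟨c, hc, hx⟩
    exact ⟨c, hc.1, hx⟩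
  · rintro ⟨c, hc, hx⟩
    have hex : ∃ k, initial x k ∈ C := ⟨c.length, by
      have : initial x c.length = c := hx
      rwa [this]⟩
    refine ⟨initial x (Nat.find hex), ⟨Nat.find_spec hex, fun t ht hts => ?_⟩,
      mem_cylinder_initial _ _⟩
    have h1 := eq_initial_of_suffix hts
    have h2 : Nat.find hex ≤ t.length := Nat.find_min' hex (h1 ▸ ht)
    exact hts.eq_of_length_le (by simpa using h2)

/-- The total weight of a set of words. -/
def cost (w : List S → ℝ≥0∞) (C : Set (List S)) : ℝ≥0∞ := ∑' l, C.indicator w l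

lemma cost_mono (w : List S → ℝ≥0∞) {C D : Set (List S)} (h : C ⊆ D) : cost w C ≤ cost w D :=
  ENNReal.tsum_le_tsum fun l => indicator_le_indicator_of_subset h (fun _ => zero_le) l

/-- The content of a set: the infimum of the cost of its coverings by cylinders. -/
def content (w : List S → ℝ≥0∞) (A : Set (ℕ → S)) : ℝ≥0∞ :=
  ⨅ (C : Set (List S)) (_ : A ⊆ covered C), cost w C

lemma content_le_cost (w : List S → ℝ≥0∞) {A : Set (ℕ → S)} {C : Set (List S)}
    (h : A ⊆ covered C) : content w A ≤ cost w C := iInf₂_le C h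

lemma exists_cost_lt {w : List S → ℝ≥0∞} {A : Set (ℕ → S)} {r : ℝ≥0∞} (h : content w A < r) :
    ∃ C, A ⊆ covered C ∧ cost w C < r := by
  simpa [content, iInf_lt_iff] using h

lemma exists_cost_le_add {w : List S → ℝ≥0∞} {A : Set (ℕ → S)} (h : content w A ≠ ⊤) {ε : ℝ≥0∞}
    (hε : ε ≠ 0) : ∃ C, A ⊆ covered C ∧ cost w C ≤ content w A + ε := by
  obtain ⟨C, h1, h2⟩ := exists_cost_lt (ENNReal.lt_add_right h hε)
  exact ⟨C, h1, h2.le⟩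

lemma content_mono (w : List S → ℝ≥0∞) {A B : Set (ℕ → S)} (h : A ⊆ B) :
    content w A ≤ content w B :=
  le_iInf₂ fun _ hC => content_le_cost w (h.trans hC)

lemma content_cylinder_le (w : List S → ℝ≥0∞) (l : List S) : content w (wordCylinder l) ≤ w l := by
  refine (content_le_cost (C := {l}) w (by simp [covered])).trans ?_
  rw [cost, ← tsum_subtype]
  simp

lemma content_iUnion_nat_le (w : List S → ℝ≥0∞) (A : ℕ → Set (ℕ → S)) :
    content w (⋃ n, A n) ≤ ∑' n, content w (A n) := by
  by_cases htop : ∑' n, content w (A n) = ⊤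
  · simp [htop]
  refine ENNReal.le_of_forall_pos_le_add fun ε hε _ => ?_
  obtain ⟨δ, hδ, hsum⟩ := ENNReal.exists_pos_sum_of_countable (ε := ε) (by simpa using hε.ne') ℕ
  choose C hC hcost using fun n => exists_cost_le_add (w := w) (A := A n)
    (fun h => htop (ENNReal.tsum_eq_top_of_eq_top ⟨n, h⟩)) (ε := δ n) (by simpa using (hδ n).ne')
  have hcov : (⋃ n, A n) ⊆ covered (⋃ n, C n) := by
    refine iUnion_subset fun n x hx => ?_
    obtain ⟨c, hc, hxc⟩ := mem_covered.1 (hC n hx)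
    exact mem_covered.2 ⟨c, mem_iUnion.2 ⟨n, hc⟩, hxc⟩
  calc content w (⋃ n, A n) ≤ cost w (⋃ n, C n) := content_le_cost w hcov
    _ ≤ ∑' n, cost w (C n) := by
        simp only [cost, ← tsum_subtype]
        exact ENNReal.tsum_iUnion_le_tsum _ _
    _ ≤ ∑' n, (content w (A n) + δ n) := ENNReal.tsum_le_tsum hcost
    _ ≤ ∑' n, content w (A n) + ε := by
        rw [ENNReal.tsum_add]
        gcongr

/-- The content as an outer measure. -/
def contentOuter (w : List S → ℝ≥0∞) : OuterMeasure (ℕ → S) where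
  measureOf := content w
  empty := by
    refine le_antisymm ((content_le_cost (C := ∅) w (empty_subset _)).trans ?_) zero_le
    simp [cost]
  mono h := content_mono w h
  iUnion_nat A _ := content_iUnion_nat_le w A

@[simp] lemma contentOuter_apply (w : List S → ℝ≥0∞) (A : Set (ℕ → S)) :
    contentOuter w A = content w A := rfl

/-- A form of strong subadditivity. Cylinders are nested or disjoint, so a point of `A` lies in a
word of `C` and a word of `D` that are either equal or such that the longer one is not maximal.
Hence the common words together with the nonmaximal ones still cover `A`, and word by word nothing
is counted more often on the left than on the right. -/
lemma cost_maximalWords_add_content_le (w : List S → ℝ≥0∞) {A : Set (ℕ → S)}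
    {C D : Set (List S)} (hC : A ⊆ covered C) (hD : A ⊆ covered D) :
    cost w (maximalWords (C ∪ D)) + content w A ≤ cost w C + cost w D := by
  classical
  set R : Set (List S) := (C ∩ D) ∪ ((C ∪ D) \ maximalWords (C ∪ D)) with hR
  have hA : A ⊆ covered R := by
    intro x hx
    obtain ⟨c, hc, hxc⟩ := mem_covered.1 (hC hx)
    obtain ⟨e, he, hxe⟩ := mem_covered.1 (hD hx)
    rw [mem_covered]
    by_cases hce : c = e
    · exact ⟨c, Or.inl ⟨hc, hce ▸ he⟩, hxc⟩
    rcases suffix_or_suffix_of_mem hxc hxe with h | h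
    · exact ⟨e, Or.inr ⟨Or.inr he, fun hm => hce (hm.2 c (Or.inl hc) h)⟩, hxe⟩
    · exact ⟨c, Or.inr ⟨Or.inl hc, fun hm => hce (hm.2 e (Or.inr he) h).symm⟩, hxc⟩
  refine (add_le_add_right (content_le_cost w hA) _).trans ?_
  simp only [cost]
  rw [← ENNReal.tsum_add, ← ENNReal.tsum_add]
  refine ENNReal.tsum_le_tsum fun l => ?_
  have hsub : l ∈ maximalWords (C ∪ D) → l ∈ C ∪ D := fun h => h.1
  by_cases h1 : l ∈ C <;> by_cases h2 : l ∈ D <;> by_cases h3 : l ∈ maximalWords (C ∪ D) <;>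
    simp_all [indicator]

/-- Continuity from below for arbitrary increasing sets, the property that makes the content a
capacity. Near-optimal covers are merged one after another, keeping maximal words only; strong
subadditivity makes the errors add up to at most `ε`. -/
lemma content_iUnion_le_iSup (w : List S → ℝ≥0∞) {A : ℕ → Set (ℕ → S)} (hA : Monotone A) :
    content w (⋃ n, A n) ≤ ⨆ n, content w (A n) := by
  by_cases htop : ⨆ n, content w (A n) = ⊤
  · simp [htop]
  have hfin : ∀ n, content w (A n) ≠ ⊤ := fun n h =>
    htop (top_le_iff.1 (h ▸ le_iSup (fun n => content w (A n)) n))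
  refine ENNReal.le_of_forall_pos_le_add fun ε hε _ => ?_
  obtain ⟨δ, hδ, hsum⟩ := ENNReal.exists_pos_sum_of_countable (ε := ε) (by simpa using hε.ne') ℕ
  choose C hC hcost using fun n => exists_cost_le_add (hfin n) (ε := δ n)
    (by simpa using (hδ n).ne')
  let D : ℕ → Set (List S) := fun n => Nat.rec (C 0) (fun n D => maximalWords (D ∪ C (n + 1))) n
  have hDs : ∀ n, D (n + 1) = maximalWords (D n ∪ C (n + 1)) := fun n => rfl
  have hDcov : ∀ n, A n ⊆ covered (D n) := by
    intro n
    cases n with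
    | zero => exact hC 0
    | succ n =>
      rw [hDs, covered_maximalWords]
      intro x hx
      obtain ⟨c, hc, hxc⟩ := mem_covered.1 (hC (n + 1) hx)
      exact mem_covered.2 ⟨c, Or.inr hc, hxc⟩
  have hDcost : ∀ n, cost w (D n) ≤ content w (A n) + ∑ k ∈ Finset.range (n + 1), (δ k : ℝ≥0∞) := by
    intro n
    induction n with
    | zero => simpa [D] using hcost 0
    | succ n ih =>
      have h1 := cost_maximalWords_add_content_le w (hDcov n)
        ((hA (Nat.le_succ n)).trans (hC (n + 1)))
      rw [← hDs] at h1
      -- Both `D n` and `C (n + 1)` cover `A n`, so its finite content appears on both sides and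
      -- cancels.
      refine (ENNReal.add_le_add_iff_right (hfin n)).1 (h1.trans ?_)
      rw [Finset.sum_range_succ _ (n + 1)]
      calc _ ≤ (content w (A n) + ∑ k ∈ Finset.range (n + 1), (δ k : ℝ≥0∞)) +
            (content w (A (n + 1)) + δ (n + 1)) := add_le_add ih (hcost (n + 1))
        _ = _ := by ring
  have hDsub : ∀ n, D n ⊆ ⋃ k, C k := by
    intro n
    induction n with
    | zero => exact subset_iUnion C 0
    | succ n ih =>
      intro c hc
      rcases hc.1 with h | h
      · exact ih h
      · exact mem_iUnion.2 ⟨n + 1, h⟩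
  -- A word maximal among all the `C k` is never discarded once it has entered. Any finite part of
  -- the limiting cover therefore lies inside a single `D n`.
  have hev : ∀ c ∈ maximalWords (⋃ k, C k), ∀ᶠ n in atTop, c ∈ D n := by
    intro c hc
    obtain ⟨k, hk⟩ := mem_iUnion.1 hc.1
    have hin : ∀ n, c ∈ D n ∪ C (n + 1) → c ∈ D (n + 1) := fun n h => ⟨h, fun t ht hts =>
      hc.2 t (ht.elim (fun h => hDsub n h) (fun h => mem_iUnion.2 ⟨n + 1, h⟩)) hts⟩
    have hkD : c ∈ D k := by
      cases k with
      | zero => exact hk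
      | succ k => exact hin k (Or.inr hk)
    filter_upwards [eventually_ge_atTop k] with n hn
    induction hn with
    | refl => exact hkD
    | step _ ih => exact hin _ (Or.inl ih)
  have hcov : (⋃ n, A n) ⊆ covered (maximalWords (⋃ k, C k)) := by
    rw [covered_maximalWords]
    refine iUnion_subset fun n x hx => ?_
    obtain ⟨c, hc, hxc⟩ := mem_covered.1 (hC n hx)
    exact mem_covered.2 ⟨c, mem_iUnion.2 ⟨n, hc⟩, hxc⟩
  refine (content_le_cost w hcov).trans ?_
  refine ENNReal.summable.tsum_le_of_sum_le fun F => ?_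
  obtain ⟨n, hn⟩ := ((eventually_all_finset F).2 fun c _ =>
    (eventually_imp_distrib_left (p := c ∈ maximalWords (⋃ k, C k))).2 (hev c)).exists
  calc ∑ c ∈ F, (maximalWords (⋃ k, C k)).indicator w c
      ≤ ∑ c ∈ F, (D n).indicator w c := by
        refine Finset.sum_le_sum fun c hc => ?_
        by_cases h : c ∈ maximalWords (⋃ k, C k)
        · rw [indicator_of_mem h, indicator_of_mem (hn c hc h)]
        · simp [indicator_of_notMem h]
    _ ≤ cost w (D n) := ENNReal.sum_le_tsum F
    _ ≤ content w (A n) + ∑ k ∈ Finset.range (n + 1), (δ k : ℝ≥0∞) := hDcost n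
    _ ≤ (⨆ n, content w (A n)) + ε := by
        gcongr
        · exact le_iSup (fun n => content w (A n)) n
        · exact (ENNReal.sum_le_tsum _).trans hsum.le

lemma apply_eq_of_initial_eq {x y : ℕ → S} {k : ℕ} (h : initial x k = initial y k) :
    ∀ i < k, x i = y i := by
  induction k with
  | zero => simp
  | succ k ih =>
    simp only [initial, List.cons.injEq] at h
    intro i hi
    rcases Nat.lt_succ_iff_lt_or_eq.1 hi with hi | rfl
    · exact ih h.2 i hi
    · exact h.1

/-! ### Capacitability of analytic sets. -/

section Topology

variable [TopologicalSpace S]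

lemma exists_cylinder_subset {O : Set (ℕ → S)} (hO : IsOpen O) {x : ℕ → S} (hx : x ∈ O) :
    ∃ k, wordCylinder (initial x k) ⊆ O := by
  obtain ⟨I, u, hu, hsub⟩ := isOpen_pi_iff.1 hO x hx
  refine ⟨I.sup id + 1, fun y hy => hsub fun i hi => ?_⟩
  have hy' : initial y (I.sup id + 1) = initial x (I.sup id + 1) := by
    simpa [wordCylinder] using hy
  rw [apply_eq_of_initial_eq hy' i (Nat.lt_succ_of_le (Finset.le_sup (f := id) hi))]
  exact (hu i hi).2

lemma covered_setOf_subset {O : Set (ℕ → S)} (hO : IsOpen O) :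
    covered {l | wordCylinder l ⊆ O} = O := by
  ext x
  rw [mem_covered]
  constructor
  · rintro ⟨c, hc, hx⟩
    exact hc hx
  · intro hx
    obtain ⟨k, hk⟩ := exists_cylinder_subset hO hx
    exact ⟨_, hk, mem_cylinder_initial x k⟩

/-- A neighbourhood of `f '' {σ | ∀ i, σ i ≤ b i}` contains `f '' {σ | ∀ i < k, σ i ≤ b i}` for
some `k`. -/
lemma exists_box_subset_preimage {f : (ℕ → ℕ) → ℕ → S} (hf : Continuous f) (b : ℕ → ℕ)
    {U : Set (ℕ → S)} (hU : IsOpen U) (h : f '' {σ | ∀ i, σ i ≤ b i} ⊆ U) :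
    ∃ k, f '' {σ | ∀ i < k, σ i ≤ b i} ⊆ U := by
  by_contra! hcon
  have hcon' : ∀ k, ∃ σ : ℕ → ℕ, (∀ i < k, σ i ≤ b i) ∧ f σ ∉ U := by
    intro k
    obtain ⟨y, ⟨σ, hσ, rfl⟩, hy⟩ := not_subset.1 (hcon k)
    exact ⟨σ, hσ, hy⟩
  choose σ hσ hσU using hcon'
  have hcomp : IsCompact {τ : ℕ → ℕ | ∀ i, τ i ≤ b i} := by
    have : {τ : ℕ → ℕ | ∀ i, τ i ≤ b i} = Set.pi univ fun i => Set.Iic (b i) := by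
      ext; simp [Pi.le_def]
    rw [this]
    exact isCompact_univ_pi fun i => (Set.finite_Iic (b i)).isCompact
  -- The truncations lie in the compact box. They agree with `σ k` in every coordinate below `k`, so
  -- the untruncated subsequence has the same limit.
  obtain ⟨τ, hτ, φ, hφ, hlim⟩ := hcomp.tendsto_subseq
    (x := fun k i => min (σ k i) (b i)) (fun k i => min_le_right _ _)
  have hlim' : Tendsto (fun k => σ (φ k)) atTop (𝓝 τ) := by
    rw [tendsto_pi_nhds] at hlim ⊢
    intro i
    refine (hlim i).congr' ?_
    filter_upwards [eventually_gt_atTop i] with k hk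
    exact min_eq_left (hσ (φ k) i (hk.trans_le (hφ.id_le k)))
  have hfl := (hf.tendsto τ).comp hlim'
  exact hU.isClosed_compl.mem_of_tendsto hfl (Eventually.of_forall fun k => hσU (φ k))
    (h ⟨τ, hτ, rfl⟩)

variable [DiscreteTopology S]

lemma isClopen_cylinder (l : List S) : IsClopen (wordCylinder l) := by
  induction l with
  | nil => rw [cylinder_nil]; exact isClopen_univ
  | cons a l ih =>
    have : wordCylinder (a :: l) = (fun x : ℕ → S => x l.length) ⁻¹' {a} ∩ wordCylinder l := by
      ext x; simp [mem_cylinder_cons]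
    rw [this]
    exact ((isClopen_discrete {a}).preimage (continuous_apply _)).inter ih

lemma isOpen_covered (C : Set (List S)) : IsOpen (covered C) :=
  isOpen_biUnion fun c _ => (isClopen_cylinder c).isOpen

/-- Choquet's argument: bound the coordinates of the parameter in `ℕ → ℕ` one at a time, keeping the
content above `c` by continuity from below. The resulting box is compact. A cover of its image by
cylinders is open, so it already covers the image of a set with finitely many bounded coordinates,
and therefore costs at least `c`. -/
lemma exists_isCompact_le_content {w : List S → ℝ≥0∞} {f : (ℕ → ℕ) → ℕ → S} (hf : Continuous f)
    {c : ℝ≥0∞} (hc : c < content w (range f)) :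
    ∃ K ⊆ range f, IsCompact K ∧ c ≤ content w K := by
  let P : ℕ → (ℕ → ℕ) → Prop := fun k b => c < content w (f '' {σ | ∀ i < k, σ i ≤ b i})
  have hstep : ∀ k b, P k b → ∃ m, P (k + 1) (Function.update b k m) := by
    intro k b hb
    let A : ℕ → Set (ℕ → S) := fun m => f '' {σ | (∀ i < k, σ i ≤ b i) ∧ σ k ≤ m}
    have hA : Monotone A := fun m m' hm => image_mono fun σ hσ => ⟨hσ.1, hσ.2.trans hm⟩
    have hU : f '' {σ | ∀ i < k, σ i ≤ b i} = ⋃ m, A m := by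
      rw [← image_iUnion]
      congr 1
      ext σ
      simp only [mem_ofPred_eq, mem_iUnion]
      exact ⟨fun h => ⟨σ k, h, le_rfl⟩, fun ⟨_, h⟩ => h.1⟩
    have h1 : c < ⨆ m, content w (A m) := by
      refine lt_of_lt_of_le hb ?_
      rw [hU]
      exact content_iUnion_le_iSup w hA
    obtain ⟨m, hm⟩ := lt_iSup_iff.1 h1
    refine ⟨m, lt_of_lt_of_le hm (content_mono w (image_mono ?_))⟩
    rintro σ ⟨h2, h3⟩ i hi
    rcases Nat.lt_succ_iff_lt_or_eq.1 hi with hi | rfl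
    · rw [Function.update_of_ne hi.ne]; exact h2 i hi
    · rwa [Function.update_self]
  choose! m hm using hstep
  let B : ℕ → ℕ → ℕ := fun k => Nat.rec (fun _ => 0) (fun k b => Function.update b k (m k b)) k
  have hBs : ∀ k, B (k + 1) = Function.update (B k) k (m k (B k)) := fun k => rfl
  have hP : ∀ k, P k (B k) := by
    intro k
    induction k with
    | zero => simpa [P, image_univ] using hc
    | succ k ih => rw [hBs]; exact hm k _ ih
  have hconst : ∀ k i, i < k → B k i = B (i + 1) i := by
    intro k i hik
    induction hik with
    | refl => rfl
    | @step j hj ih =>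
      rw [hBs, Function.update_of_ne (Nat.lt_of_succ_le hj).ne, ih]
  refine ⟨f '' {σ | ∀ i, σ i ≤ B (i + 1) i}, image_subset_range _ _, ?_, ?_⟩
  · have : {τ : ℕ → ℕ | ∀ i, τ i ≤ B (i + 1) i} = Set.pi univ fun i => Set.Iic (B (i + 1) i) := by
      ext; simp [Pi.le_def]
    rw [this]
    exact (isCompact_univ_pi fun i => (Set.finite_Iic _).isCompact).image hf
  · refine le_iInf₂ fun C hC => ?_
    obtain ⟨k, hk⟩ := exists_box_subset_preimage hf _ (isOpen_covered C) hC
    have h2 : c < content w (f '' {σ | ∀ i < k, σ i ≤ B (i + 1) i}) := by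
      have h3 := hP k
      have : {σ : ℕ → ℕ | ∀ i < k, σ i ≤ B k i} = {σ | ∀ i < k, σ i ≤ B (i + 1) i} := by
        ext σ
        exact forall₂_congr fun i hi => by rw [hconst k i hi]
      simpa only [P, this] using h3
    exact h2.le.trans (content_le_cost w hk)

end Topology

/-! ### Frostman's lemma on a tree with finite branching. -/

section Frostman

variable [Fintype S]

/-- Lengthening `l` by a digit `a` adds to the difference only the sibling cylinders, whose weights
together with that of `a :: l` make up `m l`. -/
lemma content_diff_add_le {m : List S → ℝ≥0∞} (hm : ∀ l, ∑ a, m (a :: l) = m l) {c l : List S}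
    (h : c <:+ l) : content m (wordCylinder c \ wordCylinder l) + m l ≤ m c := by
  classical
  induction l with
  | nil =>
    obtain rfl := List.suffix_nil.1 h
    simp [← contentOuter_apply]
  | cons a l ih =>
    rcases List.suffix_cons_iff.1 h with rfl | h
    · simp [← contentOuter_apply]
    have hsub : wordCylinder c \ wordCylinder (a :: l) ⊆ (wordCylinder c \ wordCylinder l) ∪
        ⋃ b ∈ Finset.univ.erase a, wordCylinder (b :: l) := by
      rintro x ⟨h1, h2⟩
      by_cases hx : x ∈ wordCylinder l
      · right
        rw [cylinder_eq_iUnion_cons, mem_iUnion] at hx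
        obtain ⟨b, hb⟩ := hx
        have hba : b ≠ a := fun h => h2 (h ▸ hb)
        simp only [mem_iUnion]
        exact ⟨b, by simp [hba], hb⟩
      · exact Or.inl ⟨h1, hx⟩
    have h1 : content m (⋃ b ∈ Finset.univ.erase a, wordCylinder (b :: l)) ≤
        ∑ b ∈ Finset.univ.erase a, m (b :: l) := by
      rw [← contentOuter_apply]
      exact (measure_biUnion_finset_le _ _).trans
        (Finset.sum_le_sum fun b _ => content_cylinder_le m _)
    calc content m (wordCylinder c \ wordCylinder (a :: l)) + m (a :: l)
        ≤ (content m (wordCylinder c \ wordCylinder l) + ∑ b ∈ Finset.univ.erase a, m (b :: l))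
            + m (a :: l) := by
          gcongr
          refine (content_mono m hsub).trans ?_
          refine (measure_union_le (μ := contentOuter m) _ _).trans ?_
          exact add_le_add_right h1 _
      _ = content m (wordCylinder c \ wordCylinder l) + m l := by
          rw [add_assoc, Finset.sum_erase_add _ _ (Finset.mem_univ a), hm]
      _ ≤ m c := ih h

/-- It suffices to split a single covering cylinder, which either is disjoint from `wordCylinder l`,
lies in it or contains it; only the last case needs additivity. -/
lemma isCaratheodory_cylinder {m : List S → ℝ≥0∞} (hm : ∀ l, ∑ a, m (a :: l) = m l)
    (l : List S) : (contentOuter m).IsCaratheodory (wordCylinder l) := by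
  rw [OuterMeasure.isCaratheodory_iff_le']
  intro t
  have hc : ∀ c, content m (wordCylinder c ∩ wordCylinder l) + content m (wordCylinder c \ wordCylinder l) ≤ m c := by
    intro c
    have h0 : content m (∅ : Set (ℕ → S)) = 0 := measure_empty (μ := contentOuter m)
    by_cases hne : (wordCylinder c ∩ wordCylinder l).Nonempty
    · obtain ⟨x, hx1, hx2⟩ := hne
      rcases suffix_or_suffix_of_mem hx1 hx2 with h | h
      · rw [add_comm]
        refine le_trans (add_le_add_right ?_ _) (content_diff_add_le hm h)
        exact (content_mono m inter_subset_right).trans (content_cylinder_le m l)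
      · rw [sdiff_eq_empty.2 (cylinder_subset_of_suffix h), h0, add_zero]
        exact (content_mono m inter_subset_left).trans (content_cylinder_le m c)
    · rw [not_nonempty_iff_eq_empty.1 hne, h0, zero_add]
      exact (content_mono m sdiff_subset).trans (content_cylinder_le m c)
  refine le_iInf₂ fun C hC => ?_
  have h1 : content m (t ∩ wordCylinder l) ≤ ∑' c : C, content m (wordCylinder (c : List S) ∩ wordCylinder l) := by
    refine (content_mono m (B := ⋃ c ∈ C, wordCylinder c ∩ wordCylinder l) ?_).trans
      (measure_biUnion_le (contentOuter m) C.to_countable _)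
    rw [← iUnion₂_inter]
    exact inter_subset_inter_left _ hC
  have h2 : content m (t \ wordCylinder l) ≤ ∑' c : C, content m (wordCylinder (c : List S) \ wordCylinder l) := by
    refine (content_mono m (B := ⋃ c ∈ C, wordCylinder c \ wordCylinder l) ?_).trans
      (measure_biUnion_le (contentOuter m) C.to_countable _)
    simp only [sdiff_eq]
    rw [← iUnion₂_inter]
    exact inter_subset_inter_left _ hC
  refine (add_le_add h1 h2).trans ?_
  rw [← ENNReal.tsum_add, cost, ← tsum_subtype]
  exact ENNReal.tsum_le_tsum fun c => hc c

/-- Distribute the mass `f []` along the tree of words in proportion to `f`. -/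
def distribute (f : List S → ℝ≥0∞) : List S → ℝ≥0∞
  | [] => f []
  | a :: l => distribute f l * (f (a :: l) / ∑ b, f (b :: l))

lemma distribute_le {f : List S → ℝ≥0∞} (hf : ∀ l, f l ≤ ∑ a, f (a :: l)) (l : List S) :
    distribute f l ≤ f l := by
  cases l with
  | nil => exact le_rfl
  | cons a l =>
    have ih := distribute_le hf l
    calc distribute f l * (f (a :: l) / ∑ b, f (b :: l))
        ≤ (∑ b, f (b :: l)) * (f (a :: l) / ∑ b, f (b :: l)) := by
          gcongr
          exact ih.trans (hf l)
      _ ≤ f (a :: l) := ENNReal.mul_div_le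

lemma sum_distribute_cons {f : List S → ℝ≥0∞} (hf : ∀ l, f l ≤ ∑ a, f (a :: l))
    (hfin : ∀ l, f l ≠ ⊤) (l : List S) : ∑ a, distribute f (a :: l) = distribute f l := by
  have hsum : ∑ a, f (a :: l) ≠ ⊤ := by simpa using fun a => hfin (a :: l)
  simp only [distribute, ← Finset.mul_sum, div_eq_mul_inv, ← Finset.sum_mul]
  -- If no child has weight then neither has the parent, so the degenerate quotient loses no mass.
  rcases eq_or_ne (∑ a, f (a :: l)) 0 with h0 | h0
  · have : distribute f l = 0 := le_antisymm ((distribute_le hf l).trans (h0 ▸ hf l)) zero_le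
    simp [this]
  · rw [ENNReal.mul_inv_cancel h0 hsum, mul_one]

/-- A covering of the whole space costs at least the total mass of an additive weight. -/
lemma le_cost_of_additive {m : List S → ℝ≥0∞} (hm : ∀ l, ∑ a, m (a :: l) = m l)
    {C : Set (List S)} (h : ∀ x : ℕ → S, x ∈ covered C) :
    m [] ≤ cost m C := by
  classical
  by_contra! hlt
  -- The cost of the words of `C` at or below `l`. If it is less than `m l`, then `l ∉ C`, and by
  -- additivity some child inherits the strict inequality. Following such children from the root
  -- gives a sequence that no word of `C` covers.
  let g : List S → ℝ≥0∞ := fun l => cost m {c ∈ C | l <:+ c}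
  have hchild : ∀ l, g l < m l → l ∉ C ∧ ∃ a, g (a :: l) < m (a :: l) := by
    intro l hl
    have hlC : l ∉ C := by
      intro hlC
      refine hl.not_ge ?_
      calc m l = cost m {l} := by rw [cost, ← tsum_subtype]; simp
        _ ≤ g l := cost_mono m (by simpa using hlC)
    refine ⟨hlC, ?_⟩
    by_contra! hcon
    refine hl.not_ge ?_
    rw [← hm l]
    refine (Finset.sum_le_sum fun a _ => hcon a).trans ?_
    simp only [g, cost]
    rw [← Summable.tsum_finsetSum fun a _ => ENNReal.summable]
    refine ENNReal.tsum_le_tsum fun c => ?_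
    by_cases hex : ∃ a, c ∈ C ∧ (a :: l) <:+ c
    · obtain ⟨a, hcC, ha⟩ := hex
      rw [Finset.sum_eq_single a]
      · rw [indicator_of_mem (show c ∈ {c ∈ C | (a :: l) <:+ c} from ⟨hcC, ha⟩),
          indicator_of_mem (show c ∈ {c ∈ C | l <:+ c} from ⟨hcC, (List.suffix_cons a l).trans ha⟩)]
      · intro b _ hb
        refine indicator_of_notMem (fun hbc => hb ?_) _
        have := (List.suffix_of_suffix_length_le hbc.2 ha (by simp)).eq_of_length (by simp)
        exact (List.cons.inj this).1
      · simp
    · push Not at hex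
      rw [Finset.sum_eq_zero]
      · exact zero_le
      · intro a _
        exact indicator_of_notMem (fun hac => hex a hac.1 hac.2) _
  have : Nonempty S := ⟨(hchild [] (by simpa [g] using hlt)).2.choose⟩
  choose! next hnext using fun l (hl : g l < m l) => (hchild l hl).2
  let L : ℕ → List S := fun k => Nat.rec [] (fun _ l => next l :: l) k
  have hL : ∀ k, g (L k) < m (L k) := by
    intro k
    induction k with
    | zero => simpa [g, L] using hlt
    | succ k ih => exact hnext _ ih
  let x : ℕ → S := fun k => next (L k)
  have hx : ∀ k, initial x k = L k := by
    intro k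
    induction k with
    | zero => rfl
    | succ k ih => simp only [initial, ih]; rfl
  obtain ⟨c, hc, hxc⟩ := mem_covered.1 (h x)
  have : L c.length = c := (hx _).symm.trans hxc
  have hn := (hchild _ (hL c.length)).1
  rw [this] at hn
  exact hn hc

variable [TopologicalSpace S] [DiscreteTopology S] [MeasurableSpace S] [BorelSpace S]

/-- The content of `K ∩ wordCylinder l` is subadditive along the tree and at most `w l`.
Distributing its total proportionally gives an additive weight below it, whose content is a Borel
measure; cylinders missing `K` receive nothing, and they exhaust the open set `Kᶜ`. -/
lemma exists_measure_le_of_isCompact {w : List S → ℝ≥0∞} (hw : ∀ l, w l ≠ ⊤) {K : Set (ℕ → S)}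
    (hK : IsCompact K) :
    ∃ μ : Measure (ℕ → S), (∀ l, μ (wordCylinder l) ≤ w l) ∧ μ Kᶜ = 0 ∧ content w K ≤ μ univ := by
  let f : List S → ℝ≥0∞ := fun l => content w (K ∩ wordCylinder l)
  have hfw : ∀ l, f l ≤ w l := fun l =>
    (content_mono w inter_subset_right).trans (content_cylinder_le w l)
  have hf : ∀ l, f l ≤ ∑ a, f (a :: l) := by
    intro l
    have : K ∩ wordCylinder l = ⋃ a ∈ Finset.univ, K ∩ wordCylinder (a :: l) := by
      rw [cylinder_eq_iUnion_cons, inter_iUnion]; simp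
    simp only [f]
    rw [this]
    exact measure_biUnion_finset_le (μ := contentOuter w) _ _
  have hfin : ∀ l, f l ≠ ⊤ := fun l => ne_top_of_le_ne_top (hw l) (hfw l)
  have hm := sum_distribute_cons hf hfin
  have hmf := distribute_le hf
  have hzero : ∀ l, wordCylinder l ⊆ Kᶜ → distribute f l = 0 := by
    intro l hl
    refine le_antisymm ((hmf l).trans ?_) zero_le
    have : K ∩ wordCylinder l = ∅ := by
      rw [← disjoint_iff_inter_eq_empty]
      exact (subset_compl_iff_disjoint_left.1 hl)
    simp only [f, this]
    exact (measure_empty (μ := contentOuter w)).le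
  have hcar : (inferInstance : MeasurableSpace (ℕ → S)) ≤
      (contentOuter (distribute f)).caratheodory := by
    rw [BorelSpace.measurable_eq (α := ℕ → S)]
    refine MeasurableSpace.generateFrom_le fun O hO => ?_
    rw [← covered_setOf_subset hO]
    exact MeasurableSet.biUnion (Set.to_countable _) fun c _ => isCaratheodory_cylinder hm c
  have happ : ∀ A, MeasurableSet A →
      (contentOuter (distribute f)).toMeasure hcar A = content (distribute f) A :=
    fun A hA => toMeasure_apply _ hcar hA
  refine ⟨(contentOuter (distribute f)).toMeasure hcar, fun l => ?_, ?_, ?_⟩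
  · rw [happ _ (isClopen_cylinder l).isOpen.measurableSet]
    exact (content_cylinder_le _ l).trans ((hmf l).trans (hfw l))
  · rw [happ _ hK.measurableSet.compl]
    refine le_antisymm ((content_le_cost _ (covered_setOf_subset
      hK.isClosed.isOpen_compl).symm.subset).trans ?_) zero_le
    exact (ENNReal.tsum_eq_zero.2 fun c => indicator_apply_eq_zero.2 (hzero c)).le
  · rw [happ _ MeasurableSet.univ]
    refine le_iInf₂ fun C hC => ?_
    have h0 : content w K = distribute f [] := by simp [distribute, f, cylinder_nil]
    rw [h0]
    exact le_cost_of_additive hm fun x => hC (mem_univ x)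

/-- Frostman's lemma on the tree of finite words over a finite alphabet, for analytic sets. -/
theorem exists_measure_le_of_analyticSet {w : List S → ℝ≥0∞} (hw : ∀ l, w l ≠ ⊤)
    {A : Set (ℕ → S)} (hA : AnalyticSet A) (hcont : content w A ≠ 0) :
    ∃ K ⊆ A, IsCompact K ∧ ∃ μ : Measure (ℕ → S), (∀ l, μ (wordCylinder l) ≤ w l) ∧ μ Kᶜ = 0 ∧
      μ univ ≠ 0 := by
  rw [AnalyticSet] at hA
  rcases hA with rfl | ⟨f, hf, rfl⟩
  · exact absurd (measure_empty (μ := contentOuter w)) hcont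
  obtain ⟨c, hc0, hc⟩ := exists_between (pos_iff_ne_zero.2 hcont)
  obtain ⟨K, hKA, hK, hcK⟩ := exists_isCompact_le_content hf hc
  obtain ⟨μ, h1, h2, h3⟩ := exists_measure_le_of_isCompact hw hK
  exact ⟨K, hKA, hK, μ, h1, h2, (hc0.trans_le (hcK.trans h3)).ne'⟩

end Frostman

end CylinderContent

open CylinderContent

/-! ### Binary coding and the comparison of dyadic content with Hausdorff measure. -/

section Coding

variable {n : ℕ}

/-- The point of `ℝ^n` with integer part `v` and binary digits `σ`. -/
def decode (v : Fin n → ℤ) (σ : ℕ → Fin n → Fin 2) : Fin n → ℝ :=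
  fun i => v i + Real.ofDigits fun k => σ k i

lemma continuous_decode (v : Fin n → ℤ) : Continuous (decode v) :=
  continuous_pi fun i => continuous_const.add
    (Real.continuous_ofDigits.comp (continuous_pi fun k => by fun_prop))

lemma exists_decode_eq (y : Fin n → ℝ) : ∃ v σ, decode v σ = y := by
  have h : ∀ i, ∃ a : ℕ → Fin 2, Real.ofDigits a = Int.fract (y i) := fun i =>
    ⟨_, Real.ofDigits_digits (by norm_num) ⟨Int.fract_nonneg _, Int.fract_lt_one _⟩⟩
  choose a ha using h
  exact ⟨fun i => ⌊y i⌋, fun k i => a i k, funext fun i => by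
    simp only [decode, ha, Int.floor_add_fract]⟩

lemma ediam_decode_image_cylinder_le (v : Fin n → ℤ) (l : List (Fin n → Fin 2)) :
    Metric.ediam (decode v '' wordCylinder l) ≤ (2⁻¹ : ℝ≥0∞) ^ l.length := by
  refine Metric.ediam_le ?_
  rintro _ ⟨σ, hσ, rfl⟩ _ ⟨τ, hτ, rfl⟩
  refine edist_pi_le_iff.2 fun i => ?_
  have h : ∀ j < l.length, σ j = τ j :=
    apply_eq_of_initial_eq (show initial σ _ = initial τ _ by
      rw [show initial σ l.length = l from hσ, show initial τ l.length = l from hτ])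
  have h2 := Real.abs_ofDigits_sub_ofDigits_le (x := fun k => σ k i) (y := fun k => τ k i)
    (n := l.length) (fun j hj => by simp only [h j hj])
  rw [edist_dist, Real.dist_eq]
  simp only [decode, add_sub_add_left_eq_sub]
  refine (ENNReal.ofReal_le_ofReal h2).trans (le_of_eq ?_)
  rw [ENNReal.ofReal_inv_of_pos (by positivity), ENNReal.ofReal_pow (by positivity),
    ENNReal.inv_pow]
  simp

/-- The weight of a word corresponding to `s`-dimensional content. -/
def dyadicWeight (n : ℕ) (s : ℝ) (l : List (Fin n → Fin 2)) : ℝ≥0∞ := ((2⁻¹ : ℝ≥0∞) ^ l.length) ^ s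

/-- Cylinders of length `k` have images of diameter at most `2^(-k)`, so cheap covers have small `∑
diam^s`. A small total also forces every diameter to be small, so covers of arbitrarily small mesh
come for free. -/
lemma hausdorffMeasure_decode_image_eq_zero {s : ℝ} (hs : 0 < s) (v : Fin n → ℤ)
    {A : Set (ℕ → Fin n → Fin 2)} (hA : content (dyadicWeight n s) A = 0) :
    μH[s] (decode v '' A) = 0 := by
  classical
  have hex : ∀ k : ℕ, ∃ C, A ⊆ covered C ∧ cost (dyadicWeight n s) C < (2⁻¹ : ℝ≥0∞) ^ k := fun k =>
    exists_cost_lt (by rw [hA]; exact ENNReal.pow_pos (by simp) k)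
  choose C hC hcost using hex
  have hpow : Tendsto (fun k : ℕ => (2⁻¹ : ℝ≥0∞) ^ k) atTop (𝓝 0) :=
    ENNReal.tendsto_pow_atTop_nhds_zero_of_lt_one (by simp)
  have hr : Tendsto (fun k : ℕ => ((2⁻¹ : ℝ≥0∞) ^ k) ^ s⁻¹) atTop (𝓝 0) := by
    have := (ENNReal.continuous_rpow_const (y := s⁻¹)).tendsto (0 : ℝ≥0∞)
    rw [ENNReal.zero_rpow_of_pos (inv_pos.2 hs)] at this
    exact this.comp hpow
  let t : ℕ → List (Fin n → Fin 2) → Set (Fin n → ℝ) := fun k l =>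
    if l ∈ C k then decode v '' wordCylinder l else ∅
  have ht : ∀ k l, Metric.ediam (t k l) ^ s ≤ (C k).indicator (dyadicWeight n s) l := by
    intro k l
    by_cases h : l ∈ C k
    · simp only [t, h, if_true, indicator_of_mem, dyadicWeight]
      exact ENNReal.rpow_le_rpow (ediam_decode_image_cylinder_le v l) hs.le
    · simp [t, h, hs]
  have hsum : ∀ k, ∑' l, Metric.ediam (t k l) ^ s ≤ (2⁻¹ : ℝ≥0∞) ^ k := fun k =>
    (ENNReal.tsum_le_tsum (ht k)).trans (hcost k).le
  have := Measure.hausdorffMeasure_le_liminf_tsum s (decode v '' A) _ hr t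
    (Eventually.of_forall fun k l => by
      rw [← ENNReal.rpow_le_rpow_iff hs, ← ENNReal.rpow_mul, inv_mul_cancel₀ hs.ne',
        ENNReal.rpow_one]
      exact (ENNReal.le_tsum l).trans (hsum k))
    (Eventually.of_forall fun k => by
      rintro _ ⟨σ, hσ, rfl⟩
      obtain ⟨c, hc, hσc⟩ := mem_covered.1 (hC k hσ)
      refine mem_iUnion.2 ⟨c, ?_⟩
      simp only [t, hc, if_true]
      exact mem_image_of_mem _ hσc)
  refine le_antisymm (this.trans ?_) zero_le
  calc liminf (fun k => ∑' l, Metric.ediam (t k l) ^ s) atTop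
      ≤ liminf (fun k : ℕ => (2⁻¹ : ℝ≥0∞) ^ k) atTop :=
        liminf_le_liminf (Eventually.of_forall hsum)
    _ = 0 := hpow.liminf_eq

/-- The integers with the binary digits given by a word. -/
def wordValue : List (Fin n → Fin 2) → Fin n → ℤ
  | [] => 0
  | a :: l => fun i => 2 * wordValue l i + (a i : ℕ)

lemma wordValue_injective {l l' : List (Fin n → Fin 2)} (hlen : l.length = l'.length)
    (h : wordValue l = wordValue l') : l = l' := by
  induction l generalizing l' with
  | nil => exact (List.length_eq_zero_iff.1 hlen.symm).symm
  | cons a l ih =>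
    cases l' with
    | nil => simp at hlen
    | cons a' l' =>
      have h' : ∀ i, wordValue l i = wordValue l' i ∧ a i = a' i := by
        intro i
        have h1 : 2 * wordValue l i + ((a i : ℕ) : ℤ) = 2 * wordValue l' i + ((a' i : ℕ) : ℤ) :=
          congrFun h i
        have h2 := (a i).isLt
        have h3 := (a' i).isLt
        refine ⟨by omega, Fin.ext (by omega)⟩
      rw [ih (by simpa using hlen) (funext fun i => (h' i).1), funext fun i => (h' i).2]

lemma wordValue_initial (σ : ℕ → Fin n → Fin 2) (k : ℕ) (i : Fin n) :
    (wordValue (initial σ k) i : ℝ) =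
      2 ^ k * ∑ j ∈ Finset.range k, Real.ofDigitsTerm (fun j => σ j i) j := by
  induction k with
  | zero => simp [initial, wordValue]
  | succ k ih =>
    have h : (2 : ℝ) ^ (k + 1) * Real.ofDigitsTerm (fun j => σ j i) k = (σ k i : ℕ) := by
      simp only [Real.ofDigitsTerm]
      push_cast
      field_simp
    rw [Finset.sum_range_succ, mul_add, h, pow_succ', mul_assoc, ← ih]
    simp [initial, wordValue]

lemma wordValue_le (σ : ℕ → Fin n → Fin 2) (k : ℕ) (i : Fin n) :
    (wordValue (initial σ k) i : ℝ) ≤ 2 ^ k * Real.ofDigits (fun j => σ j i) ∧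
      2 ^ k * Real.ofDigits (fun j => σ j i) ≤ wordValue (initial σ k) i + 1 := by
  have h := Real.ofDigits_eq_sum_add_ofDigits (fun j => σ j i) k
  have h0 := Real.ofDigits_nonneg (fun j => σ (j + k) i)
  have h1 := Real.ofDigits_le_one (fun j => σ (j + k) i)
  have h2 : 2 ^ k * Real.ofDigits (fun j => σ j i) =
      wordValue (initial σ k) i + Real.ofDigits (fun j => σ (j + k) i) := by
    rw [h, wordValue_initial, mul_add]
    congr 1
    push_cast
    rw [← mul_assoc, mul_inv_cancel₀ (by positivity), one_mul]
  constructor <;> linarith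

/-- A sup-norm ball of radius `2^(-k)` meets at most `4^n` closed dyadic cubes of side `2^(-k)`,
each coming from one word of length `k`. -/
lemma measure_decode_preimage_closedBall_le {s : ℝ} {μ : Measure (ℕ → Fin n → Fin 2)}
    (hμ : ∀ l, μ (wordCylinder l) ≤ dyadicWeight n s l) (v : Fin n → ℤ) (y : Fin n → ℝ) (k : ℕ) :
    μ (decode v ⁻¹' Metric.closedBall y ((2⁻¹ : ℝ) ^ k)) ≤ 4 ^ n * ((2⁻¹ : ℝ≥0∞) ^ k) ^ s := by
  let q : Fin n → ℝ := fun i => 2 ^ k * (y i - v i)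
  -- An integer `w` with `w ≤ p ≤ w + 1` and `|p - q| ≤ 1` satisfies `q - 2 ≤ w ≤ q + 1`. The upper
  -- end `w + 1` is attained by digits that are eventually all `1`.
  let I : Finset (Fin n → ℤ) := Fintype.piFinset fun i => Finset.Icc (⌊q i⌋ - 2) (⌊q i⌋ + 1)
  have hcard : I.card = 4 ^ n := by
    simp only [I, Fintype.card_piFinset, Int.card_Icc]
    rw [Finset.prod_congr rfl (g := fun _ => 4)]
    · simp
    · intro i _
      rw [show ⌊q i⌋ + 1 + 1 - (⌊q i⌋ - 2) = 4 by ring]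
      rfl
  have hsub : decode v ⁻¹' Metric.closedBall y ((2⁻¹ : ℝ) ^ k) ⊆
      ⋃ u ∈ I, {σ | wordValue (initial σ k) = u} := by
    intro σ hσ
    simp only [mem_iUnion]
    refine ⟨wordValue (initial σ k), Fintype.mem_piFinset.2 fun i => ?_, rfl⟩
    have h1 := (dist_pi_le_iff (by positivity)).1 (Metric.mem_closedBall.1 hσ) i
    rw [Real.dist_eq, inv_pow] at h1
    have hp : (0 : ℝ) < 2 ^ k := by positivity
    have h2 : |2 ^ k * Real.ofDigits (fun j => σ j i) - q i| ≤ 1 := by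
      have : 2 ^ k * Real.ofDigits (fun j => σ j i) - q i = 2 ^ k * (decode v σ i - y i) := by
        simp only [q, decode]; ring
      rw [this, abs_mul, abs_of_pos hp]
      calc 2 ^ k * |decode v σ i - y i| ≤ 2 ^ k * (2 ^ k)⁻¹ := by gcongr
        _ = 1 := mul_inv_cancel₀ hp.ne'
    obtain ⟨h3, h4⟩ := wordValue_le σ k i
    rw [abs_le] at h2
    have h5 := Int.floor_le (q i)
    have h6 := Int.lt_floor_add_one (q i)
    rw [Finset.mem_Icc]
    constructor
    · have : ((⌊q i⌋ - 2 : ℤ) : ℝ) ≤ wordValue (initial σ k) i := by push_cast; linarith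
      exact_mod_cast this
    · have : (wordValue (initial σ k) i : ℝ) < ((⌊q i⌋ + 2 : ℤ) : ℝ) := by push_cast; linarith
      have : wordValue (initial σ k) i < ⌊q i⌋ + 2 := by exact_mod_cast this
      omega
  have hone : ∀ u, μ {σ | wordValue (initial σ k) = u} ≤ ((2⁻¹ : ℝ≥0∞) ^ k) ^ s := by
    intro u
    rcases eq_empty_or_nonempty {σ : ℕ → Fin n → Fin 2 | wordValue (initial σ k) = u} with h | h
    · simp [h]
    obtain ⟨τ, hτ⟩ := h
    have hτ' : wordValue (initial τ k) = u := hτ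
    calc μ {σ | wordValue (initial σ k) = u} ≤ μ (wordCylinder (initial τ k)) := by
          refine measure_mono fun σ hσ => ?_
          have hσ' : wordValue (initial σ k) = u := hσ
          have := wordValue_injective (by simp) (hσ'.trans hτ'.symm)
          simpa [CylinderContent.wordCylinder] using this
      _ ≤ _ := (hμ _).trans (by simp [dyadicWeight])
  calc μ (decode v ⁻¹' Metric.closedBall y ((2⁻¹ : ℝ) ^ k))
      ≤ ∑ u ∈ I, μ {σ | wordValue (initial σ k) = u} :=
        (measure_mono hsub).trans (measure_biUnion_finset_le _ _)
    _ ≤ ∑ u ∈ I, ((2⁻¹ : ℝ≥0∞) ^ k) ^ s := Finset.sum_le_sum fun u _ => hone u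
    _ = 4 ^ n * ((2⁻¹ : ℝ≥0∞) ^ k) ^ s := by rw [Finset.sum_const, hcard]; simp

lemma measure_decode_preimage_closedBall_le_rpow {s : ℝ} (hs : 0 < s)
    {μ : Measure (ℕ → Fin n → Fin 2)}
    (hμ : ∀ l, μ (wordCylinder l) ≤ dyadicWeight n s l) (v : Fin n → ℤ) (y : Fin n → ℝ) {r : ℝ}
    (hr : 0 < r) :
    μ (decode v ⁻¹' Metric.closedBall y r) ≤ 4 ^ n * 2 ^ s * ENNReal.ofReal r ^ s := by
  rcases le_or_gt 1 r with h1 | h1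
  · have h2 : μ univ ≤ 1 := by simpa [cylinder_nil, dyadicWeight] using hμ []
    refine (measure_mono (subset_univ _)).trans (h2.trans ?_)
    have h3 : (1 : ℝ≥0∞) ≤ 4 ^ n := one_le_pow₀ (by norm_num)
    have h4 : (1 : ℝ≥0∞) ≤ 2 ^ s := ENNReal.one_le_rpow (by norm_num) hs
    have h5 : (1 : ℝ≥0∞) ≤ ENNReal.ofReal r ^ s :=
      ENNReal.one_le_rpow (ENNReal.one_le_ofReal.2 h1) hs
    calc (1 : ℝ≥0∞) = 1 * 1 * 1 := by simp
      _ ≤ _ := by gcongr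
  · obtain ⟨k, hk1, hk2⟩ := exists_nat_pow_near_of_lt_one hr h1.le (y := (2⁻¹ : ℝ))
      (by norm_num) (by norm_num)
    refine (measure_mono (preimage_mono (Metric.closedBall_subset_closedBall hk2))).trans ?_
    refine (measure_decode_preimage_closedBall_le hμ v y k).trans ?_
    rw [mul_assoc, ← ENNReal.mul_rpow_of_nonneg _ _ hs.le]
    gcongr
    have h6 : (2⁻¹ : ℝ≥0∞) ^ k = ENNReal.ofReal ((2⁻¹ : ℝ) ^ k) := by
      rw [ENNReal.ofReal_pow (by positivity), ENNReal.ofReal_inv_of_pos (by positivity)]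
      simp
    rw [h6, show (2 : ℝ≥0∞) = ENNReal.ofReal 2 by simp, ← ENNReal.ofReal_mul (by norm_num)]
    refine ENNReal.ofReal_le_ofReal ?_
    rw [pow_succ] at hk1
    linarith

end Coding

/-! ### Frostman measures in finite-dimensional spaces. -/

/-- Frostman's lemma for Borel sets in finite-dimensional normed spaces. -/
theorem exists_frostman_measure {V : Type*} [NormedAddCommGroup V] [NormedSpace ℝ V]
    [FiniteDimensional ℝ V] [MeasurableSpace V] [BorelSpace V] {E : Set V} (hE : MeasurableSet E)
    {s : ℝ} (hs : 0 < s) (hdim : ENNReal.ofReal s < dimH E) :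
    ∃ K ⊆ E, IsCompact K ∧ ∃ μ : Measure V, IsProbabilityMeasure μ ∧ μ Kᶜ = 0 ∧
      ∃ C : ℝ≥0∞, C ≠ ⊤ ∧ ∀ x, ∀ r > 0, μ (Metric.closedBall x r) ≤ C * ENNReal.ofReal r ^ s := by
  let n := Module.finrank ℝ V
  let e : V ≃L[ℝ] (Fin n → ℝ) := (Module.finBasis ℝ V).equivFunL
  let g : (Fin n → ℤ) → (ℕ → Fin n → Fin 2) → V := fun v σ => e.symm (decode v σ)
  have hg : ∀ v, Continuous (g v) := fun v => e.symm.continuous.comp (continuous_decode v)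
  -- If every unit-cube piece had zero content, `e '' E` would be a null set for `μH[s]`, although
  -- `s` is below its dimension.
  obtain ⟨v, hv⟩ : ∃ v, content (dyadicWeight n s) (g v ⁻¹' E) ≠ 0 := by
    by_contra! hcon
    have hzero : μH[s] (e '' E) = 0 := by
      refine measure_mono_null ?_ (measure_iUnion_null fun v =>
        hausdorffMeasure_decode_image_eq_zero hs v (hcon v))
      rintro _ ⟨x, hx, rfl⟩
      obtain ⟨v, σ, hσ⟩ := exists_decode_eq (e x)
      exact mem_iUnion.2 ⟨v, σ, by simpa [g, hσ] using hx, hσ⟩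
    have h1 := hausdorffMeasure_of_lt_dimH (X := Fin n → ℝ) (s := e '' E) (d := s.toNNReal)
      (by rw [e.dimH_image]; exact hdim)
    rw [Real.coe_toNNReal _ hs.le, hzero] at h1
    exact ENNReal.zero_ne_top h1
  obtain ⟨K, hKE, hK, μ, hμ, hμK, hμ0⟩ := exists_measure_le_of_analyticSet (S := Fin n → Fin 2)
    (w := dyadicWeight n s)
    (fun l => ENNReal.rpow_ne_top_of_nonneg hs.le (ENNReal.pow_ne_top (by simp)))
    ((hg v).measurable hE).analyticSet hv
  have hfin : μ univ ≠ ⊤ := ne_top_of_le_ne_top ENNReal.one_ne_top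
    (by simpa [cylinder_nil, dyadicWeight] using hμ [])
  have happ : ∀ A, MeasurableSet A → ((μ univ)⁻¹ • μ.map (g v)) A = (μ univ)⁻¹ * μ (g v ⁻¹' A) :=
    fun A hA => by
      rw [Measure.smul_apply, Measure.map_apply (hg v).measurable hA, smul_eq_mul]
  have hgK : IsCompact (g v '' K) := hK.image (hg v)
  refine ⟨g v '' K, image_subset_iff.2 hKE, hgK, (μ univ)⁻¹ • μ.map (g v), ⟨?_⟩, ?_, ?_⟩
  · rw [happ _ MeasurableSet.univ, preimage_univ, ENNReal.inv_mul_cancel hμ0 hfin]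
  · rw [happ _ hgK.measurableSet.compl]
    refine mul_eq_zero_of_right _ (measure_mono_null ?_ hμK)
    exact fun σ hσ hσK => hσ (mem_image_of_mem _ hσK)
  · let L : ℝ := ‖(e : V →L[ℝ] (Fin n → ℝ))‖ + 1
    have hL : 0 < L := by positivity
    refine ⟨(μ univ)⁻¹ * (4 ^ n * 2 ^ s * ENNReal.ofReal L ^ s), ?_, fun x r hr => ?_⟩
    · refine ENNReal.mul_ne_top (ENNReal.inv_ne_top.2 hμ0) (ENNReal.mul_ne_top
        (ENNReal.mul_ne_top (by simp) ?_) ?_) <;>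
      exact ENNReal.rpow_ne_top_of_nonneg hs.le (by simp)
    · rw [happ _ Metric.isClosed_closedBall.measurableSet, mul_assoc]
      gcongr
      have hsub : g v ⁻¹' Metric.closedBall x r ⊆
          decode v ⁻¹' Metric.closedBall (e x) (L * r) := by
        intro σ hσ
        have h1 : ‖g v σ - x‖ ≤ r := by simpa [dist_eq_norm] using hσ
        have h2 : decode v σ - e x = (e : V →L[ℝ] (Fin n → ℝ)) (g v σ - x) := by simp [g]
        rw [mem_preimage, Metric.mem_closedBall, dist_eq_norm, h2]
        refine (ContinuousLinearMap.le_opNorm _ _).trans ?_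
        gcongr
        simp [L]
      refine (measure_mono hsub).trans
        ((measure_decode_preimage_closedBall_le_rpow hs hμ v _ (by positivity)).trans ?_)
      rw [ENNReal.ofReal_mul hL.le, ENNReal.mul_rpow_of_nonneg _ _ hs.le]
      exact le_of_eq (by ring)

/-- A nonempty Borel set carries a compactly supported measure satisfying the Frostman condition
with some exponent above any number smaller than the Hausdorff dimension. -/
theorem exists_frostman_measure_of_nonempty {V : Type*} [NormedAddCommGroup V] [NormedSpace ℝ V]
    [FiniteDimensional ℝ V] [MeasurableSpace V] [BorelSpace V] {E : Set V} (hE : MeasurableSet E)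
    (hne : E.Nonempty) {b : ℝ} (hb : b < (dimH E).toReal) :
    ∃ s, 0 ≤ s ∧ b < s ∧ ∃ K ⊆ E, IsCompact K ∧ ∃ μ : Measure V, IsProbabilityMeasure μ ∧
      μ Kᶜ = 0 ∧ ∃ C : ℝ≥0∞, C ≠ ⊤ ∧ ∀ x, ∀ r > 0,
        μ (Metric.closedBall x r) ≤ C * ENNReal.ofReal r ^ s := by
  -- A set of dimension zero need not carry a measure with a positive exponent; a Dirac mass serves
  -- with exponent `0`.
  rcases lt_or_ge b 0 with hb0 | hb0
  · obtain ⟨x, hx⟩ := hne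
    refine ⟨0, le_rfl, hb0, {x}, singleton_subset_iff.2 hx, isCompact_singleton,
      Measure.dirac x, inferInstance, by simp, 1, by simp, fun y r _ => ?_⟩
    simpa using prob_le_one (μ := Measure.dirac x)
  · obtain ⟨s, hbs, hs⟩ := exists_between hb
    have hs0 : 0 < s := hb0.trans_lt hbs
    exact ⟨s, hs0.le, hbs, exists_frostman_measure hE hs0
      ((ENNReal.ofReal_lt_iff_lt_toReal hs0.le (Real.dimH_ne_top E)).2 hs)⟩

/-! ### Gaussian-weighted `L²` norms of Fourier transforms as energies. -/

section GaussianEnergy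

variable {W : Type*} [NormedAddCommGroup W] [InnerProductSpace ℝ W] [FiniteDimensional ℝ W]
  [MeasurableSpace W] [BorelSpace W]

lemma integral_cexp_neg_two_pi_I_inner_mul_gaussian {b : ℝ} (hb : 0 < b) (w : W) :
    ∫ t : W, Complex.exp (-2 * Real.pi * Complex.I * (inner ℝ t w : ℝ)) *
        (Real.exp (-Real.pi * b * ‖t‖ ^ 2) : ℝ) =
      ((b⁻¹ ^ (Module.finrank ℝ W / 2 : ℝ) * Real.exp (-Real.pi / b * ‖w‖ ^ 2) : ℝ) : ℂ) := by
  have h := GaussianFourier.integral_cexp_neg_mul_sq_norm_add (b := (Real.pi * b : ℝ))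
    (by rw [Complex.ofReal_re]; positivity) (-2 * Real.pi * Complex.I) w
  have hpi := Real.pi_pos
  rw [show (fun t : W => Complex.exp (-2 * Real.pi * Complex.I * (inner ℝ t w : ℝ)) *
        ((Real.exp (-Real.pi * b * ‖t‖ ^ 2) : ℝ) : ℂ)) =
      fun t : W => Complex.exp (-((Real.pi * b : ℝ) : ℂ) * ‖t‖ ^ 2 +
        (-2 * Real.pi * Complex.I) * (inner ℝ w t : ℝ)) from by
    funext t
    rw [Complex.ofReal_exp, ← Complex.exp_add, real_inner_comm]
    congr 1
    push_cast
    ring, h]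
  push_cast
  rw [Complex.ofReal_cpow (by positivity)]
  have hpi' : (Real.pi : ℂ) ≠ 0 := by exact_mod_cast hpi.ne'
  have hb' : (b : ℂ) ≠ 0 := by exact_mod_cast hb.ne'
  congr 2
  · push_cast
    field_simp
  · push_cast
    rfl
  · rw [mul_pow, mul_pow, Complex.I_sq]
    field_simp
    ring

lemma integrable_exp_neg_mul_sq_norm {b : ℝ} (hb : 0 < b) :
    Integrable fun t : W => Real.exp (-Real.pi * b * ‖t‖ ^ 2) := by
  have h := GaussianFourier.integrable_cexp_neg_mul_sq_norm_add (b := (Real.pi * b : ℝ))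
    (by rw [Complex.ofReal_re]; have := Real.pi_pos; positivity) 0 (0 : W)
  refine h.norm.congr (Eventually.of_forall fun t => ?_)
  simp only [Complex.norm_exp]
  congr 1
  simp [← Complex.ofReal_pow, ← Complex.ofReal_mul]

lemma norm_cexp_neg_two_pi_I_mul (u : ℝ) :
    ‖Complex.exp (-2 * Real.pi * Complex.I * (u : ℝ))‖ = 1 := by
  rw [show (-2 * Real.pi * Complex.I * (u : ℝ) : ℂ) = ((-2 * Real.pi * u : ℝ) : ℂ) * Complex.I by
    push_cast; ring, Complex.norm_exp_ofReal_mul_I]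

lemma conj_cexp_neg_two_pi_I_mul (u : ℝ) :
    (starRingEnd ℂ) (Complex.exp (-2 * Real.pi * Complex.I * (u : ℝ))) =
      Complex.exp (-2 * Real.pi * Complex.I * ((-u : ℝ) : ℝ)) := by
  rw [← Complex.exp_conj]
  congr 1
  simp [map_ofNat]

variable {Y : Type*} [MeasurableSpace Y] {κ : Measure Y} [SFinite κ]

/-- The Gaussian-weighted square integral of the Fourier transform of the measure `a κ`, transported
by `L`, is a Gaussian energy. -/
theorem lintegral_norm_sq_integral_mul_gaussian {a : Y → ℝ} (ha : Integrable a κ)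
    (ha0 : ∀ y, 0 ≤ a y) {L : Y → W} (hL : Measurable L) {b : ℝ} (hb : 0 < b) :
    ∫⁻ t : W, ENNReal.ofReal (‖∫ y, a y *
        Complex.exp (-2 * Real.pi * Complex.I * (inner ℝ t (L y) : ℝ)) ∂κ‖ ^ 2 *
          Real.exp (-Real.pi * b * ‖t‖ ^ 2)) =
      ENNReal.ofReal (b⁻¹ ^ (Module.finrank ℝ W / 2 : ℝ)) * ∫⁻ y, ∫⁻ y',
        ENNReal.ofReal (a y * a y' * Real.exp (-Real.pi / b * ‖L y - L y'‖ ^ 2)) ∂κ ∂κ := by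
  set f : W → Y → ℂ := fun t y =>
    a y * Complex.exp (-2 * Real.pi * Complex.I * (inner ℝ t (L y) : ℝ)) with hf
  set c : ℝ := b⁻¹ ^ (Module.finrank ℝ W / 2 : ℝ) with hc
  have hc0 : 0 ≤ c := by positivity
  -- Expand the square as a double integral over `Y × Y`; after Fubini the `t`-integral is the
  -- Fourier transform of a Gaussian at `L y - L y'`.
  let H : W × (Y × Y) → ℂ := fun q => f q.1 q.2.1 * (starRingEnd ℂ) (f q.1 q.2.2) *
    (Real.exp (-Real.pi * b * ‖q.1‖ ^ 2) : ℝ)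
  have ha2 : Integrable (fun p : Y × Y => a p.1 * a p.2) (κ.prod κ) := ha.mul_prod ha
  have hHint : Integrable H (volume.prod (κ.prod κ)) := by
    refine Integrable.mono' ((integrable_exp_neg_mul_sq_norm (W := W) hb).mul_prod ha2) ?_ ?_
    · have h1 : AEStronglyMeasurable (fun q : W × (Y × Y) => ((a q.2.1 : ℝ) : ℂ))
          (volume.prod (κ.prod κ)) := Complex.continuous_ofReal.comp_aestronglyMeasurable
            (ha.1.comp_fst.comp_snd)
      have h2 : AEStronglyMeasurable (fun q : W × (Y × Y) => ((a q.2.2 : ℝ) : ℂ))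
          (volume.prod (κ.prod κ)) := Complex.continuous_ofReal.comp_aestronglyMeasurable
            (ha.1.comp_snd.comp_snd)
      have h3 : Measurable fun q : W × (Y × Y) =>
          Complex.exp (-2 * Real.pi * Complex.I * (inner ℝ q.1 (L q.2.1) : ℝ)) := by fun_prop
      have h4 : Measurable fun q : W × (Y × Y) =>
          Complex.exp (-2 * Real.pi * Complex.I * (inner ℝ q.1 (L q.2.2) : ℝ)) := by fun_prop
      have h5 : Measurable fun q : W × (Y × Y) =>
          ((Real.exp (-Real.pi * b * ‖q.1‖ ^ 2) : ℝ) : ℂ) := by fun_prop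
      exact ((h1.mul h3.aestronglyMeasurable).mul
        (Complex.continuous_conj.comp_aestronglyMeasurable
          (h2.mul h4.aestronglyMeasurable))).mul h5.aestronglyMeasurable
    · refine Eventually.of_forall fun q => le_of_eq ?_
      simp only [H, hf, norm_mul, RCLike.norm_conj, norm_cexp_neg_two_pi_I_mul, Complex.norm_real,
        Real.norm_eq_abs, abs_of_nonneg (ha0 _), Real.abs_exp]
      ring
  have h1 : ∀ t : W, ∫ p, H (t, p) ∂(κ.prod κ) =
      ((‖∫ y, f t y ∂κ‖ ^ 2 * Real.exp (-Real.pi * b * ‖t‖ ^ 2) : ℝ) : ℂ) := by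
    intro t
    simp only [H]
    rw [integral_mul_const, integral_prod_mul (fun y => f t y)
      (fun y => (starRingEnd ℂ) (f t y)), integral_conj, Complex.mul_conj, Complex.normSq_eq_norm_sq]
    push_cast
    rfl
  have h2 : ∀ p : Y × Y, ∫ t : W, H (t, p) =
      ((c * (a p.1 * a p.2 * Real.exp (-Real.pi / b * ‖L p.1 - L p.2‖ ^ 2)) : ℝ) : ℂ) := by
    intro p
    have h3 : ∀ t : W, H (t, p) = ((a p.1 * a p.2 : ℝ) : ℂ) *
        (Complex.exp (-2 * Real.pi * Complex.I * (inner ℝ t (L p.1 - L p.2) : ℝ)) *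
          (Real.exp (-Real.pi * b * ‖t‖ ^ 2) : ℝ)) := by
      intro t
      simp only [H, hf, map_mul, conj_cexp_neg_two_pi_I_mul, Complex.conj_ofReal, inner_sub_right]
      rw [show (-2 * Real.pi * Complex.I * ((inner ℝ t (L p.1) - inner ℝ t (L p.2) : ℝ) : ℂ) : ℂ) =
        -2 * Real.pi * Complex.I * (inner ℝ t (L p.1) : ℝ) +
        -2 * Real.pi * Complex.I * ((-inner ℝ t (L p.2) : ℝ) : ℂ) by push_cast; ring,
        Complex.exp_add]
      push_cast
      ring
    simp only [h3]
    rw [integral_const_mul, integral_cexp_neg_two_pi_I_inner_mul_gaussian hb]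
    push_cast
    ring
  have hswap : ∫ t : W, (‖∫ y, f t y ∂κ‖ ^ 2 * Real.exp (-Real.pi * b * ‖t‖ ^ 2)) =
      ∫ p, c * (a p.1 * a p.2 * Real.exp (-Real.pi / b * ‖L p.1 - L p.2‖ ^ 2)) ∂(κ.prod κ) := by
    have := integral_integral_swap (f := fun t p => H (t, p)) hHint
    simp only [h1, h2] at this
    rw [integral_complex_ofReal, integral_complex_ofReal] at this
    exact_mod_cast this
  have hint1 : Integrable fun t : W =>
      ‖∫ y, f t y ∂κ‖ ^ 2 * Real.exp (-Real.pi * b * ‖t‖ ^ 2) := by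
    have := hHint.integral_prod_left
    simp only [h1] at this
    exact this.re
  have hint2 : Integrable (fun p : Y × Y =>
      c * (a p.1 * a p.2 * Real.exp (-Real.pi / b * ‖L p.1 - L p.2‖ ^ 2))) (κ.prod κ) := by
    have := hHint.integral_prod_right
    simp only [h2] at this
    exact this.re
  rw [← ofReal_integral_eq_lintegral_ofReal hint1 (Eventually.of_forall fun t => by positivity),
    hswap, ofReal_integral_eq_lintegral_ofReal hint2 (Eventually.of_forall fun p => by
      have := ha0 p.1; have := ha0 p.2; positivity)]
  have hm : AEMeasurable (fun p : Y × Y =>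
      ENNReal.ofReal (a p.1 * a p.2 * Real.exp (-Real.pi / b * ‖L p.1 - L p.2‖ ^ 2)))
      (κ.prod κ) := by
    refine AEMeasurable.ennreal_ofReal (ha2.1.aemeasurable.mul (Measurable.aemeasurable ?_))
    fun_prop
  simp only [ENNReal.ofReal_mul hc0]
  rw [lintegral_const_mul'' _ hm, lintegral_prod _ hm]

end GaussianEnergy

/-! ### Gaussian averages of Frostman measures over balls and slabs. -/

section Decay

/-- The Gaussian integral of a Gaussian ridge in the direction `ξ`. -/
lemma lintegral_gaussian_ridge_le {W : Type*} [NormedAddCommGroup W] [InnerProductSpace ℝ W]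
    [FiniteDimensional ℝ W] [MeasurableSpace W] [BorelSpace W] {ξ : W} (hξ : ξ ≠ 0) (τ : ℝ) :
    ∫⁻ p : W, ENNReal.ofReal (Real.exp (-Real.pi * (inner ℝ ξ p - τ) ^ 2) *
      Real.exp (-Real.pi * ‖p‖ ^ 2)) ≤ ENNReal.ofReal ‖ξ‖⁻¹ := by
  let e : ℝ → ℂ := fun u => Complex.exp (-2 * Real.pi * Complex.I * (u : ℝ))
  have he : Continuous e := by fun_prop
  -- The ridge is the integral over `v` of `e^(-πv²)` times a character in `v (ξ·p - τ)`.
  -- Integrating in `p` first leaves at most `e^(-π|ξ|²v²)` in modulus, with integral `1/|ξ|`.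
  let H : W × ℝ → ℂ := fun q => (Real.exp (-Real.pi * ‖q.1‖ ^ 2) : ℝ) *
    ((Real.exp (-Real.pi * q.2 ^ 2) : ℝ) * e (q.2 * (inner ℝ ξ q.1 - τ)))
  have hgW : Integrable fun t : W => Real.exp (-Real.pi * ‖t‖ ^ 2) := by
    simpa using integrable_exp_neg_mul_sq_norm (W := W) one_pos
  have hgR : Integrable fun t : ℝ => Real.exp (-Real.pi * t ^ 2) := by
    simpa using integrable_exp_neg_mul_sq_norm (W := ℝ) one_pos
  have hH : Integrable H (volume.prod volume) := by
    refine Integrable.mono' (hgW.mul_prod hgR) (Continuous.aestronglyMeasurable ?_)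
      (Eventually.of_forall fun q => le_of_eq ?_)
    · fun_prop
    · simp only [H, e, norm_mul, norm_cexp_neg_two_pi_I_mul, Complex.norm_real, Real.norm_eq_abs,
        Real.abs_exp, mul_one]
  have h1 : ∀ p : W, ∫ v : ℝ, H (p, v) = ((Real.exp (-Real.pi * (inner ℝ ξ p - τ) ^ 2) *
      Real.exp (-Real.pi * ‖p‖ ^ 2) : ℝ) : ℂ) := by
    intro p
    have h := integral_cexp_neg_two_pi_I_inner_mul_gaussian (W := ℝ) one_pos (inner ℝ ξ p - τ)
    simp only [H]
    rw [integral_const_mul]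
    have h' : ∫ v : ℝ, ((Real.exp (-Real.pi * v ^ 2) : ℝ) : ℂ) * e (v * (inner ℝ ξ p - τ)) =
        ((Real.exp (-Real.pi * (inner ℝ ξ p - τ) ^ 2) : ℝ) : ℂ) := by
      simp only [inv_one, Real.one_rpow, div_one, one_mul, mul_one, Real.norm_eq_abs, sq_abs] at h
      rw [← h]
      refine integral_congr_ae (Eventually.of_forall fun v => ?_)
      simp only [e]
      rw [mul_comm, show inner ℝ v (inner ℝ ξ p - τ) = v * (inner ℝ ξ p - τ) from by
        simp [mul_comm]]
    rw [h']
    push_cast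
    ring
  have h2 : ∀ v : ℝ, ‖∫ p : W, H (p, v)‖ ≤ Real.exp (-Real.pi * ‖ξ‖ ^ 2 * v ^ 2) := by
    intro v
    have h := integral_cexp_neg_two_pi_I_inner_mul_gaussian (W := W) one_pos (v • ξ)
    have h' : ∀ p : W, H (p, v) = ((Real.exp (-Real.pi * v ^ 2) : ℝ) * e (-(v * τ))) *
        (Complex.exp (-2 * Real.pi * Complex.I * (inner ℝ p (v • ξ) : ℝ)) *
          (Real.exp (-Real.pi * 1 * ‖p‖ ^ 2) : ℝ)) := by
      intro p
      have : e (v * (inner ℝ ξ p - τ)) = e (-(v * τ)) *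
          Complex.exp (-2 * Real.pi * Complex.I * (inner ℝ p (v • ξ) : ℝ)) := by
        simp only [e]
        rw [← Complex.exp_add, inner_smul_right, real_inner_comm]
        congr 1
        push_cast
        ring
      simp only [H, this, mul_one]
      ring
    simp only [h']
    rw [integral_const_mul, h]
    simp only [e, norm_mul, norm_cexp_neg_two_pi_I_mul, Complex.norm_real, Real.norm_eq_abs,
      Real.abs_exp, mul_one, inv_one, Real.one_rpow, div_one, one_mul, norm_smul, mul_pow, sq_abs]
    rw [← Real.exp_add]
    refine Real.exp_le_exp.2 ?_
    nlinarith [mul_nonneg Real.pi_pos.le (sq_nonneg v)]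
  have hξ' : 0 < ‖ξ‖ := norm_pos_iff.2 hξ
  have hint : Integrable fun p : W => Real.exp (-Real.pi * (inner ℝ ξ p - τ) ^ 2) *
      Real.exp (-Real.pi * ‖p‖ ^ 2) := by
    have := hH.integral_prod_left
    simp only [h1] at this
    exact this.re
  rw [← ofReal_integral_eq_lintegral_ofReal hint (Eventually.of_forall fun p => by positivity)]
  refine ENNReal.ofReal_le_ofReal ?_
  have hswap := integral_integral_swap (f := fun p v => H (p, v)) hH
  simp only [h1] at hswap
  rw [integral_complex_ofReal] at hswap
  have hpos : 0 ≤ ∫ p : W, Real.exp (-Real.pi * (inner ℝ ξ p - τ) ^ 2) *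
      Real.exp (-Real.pi * ‖p‖ ^ 2) := integral_nonneg fun p => by positivity
  rw [← abs_of_nonneg hpos, ← Real.norm_eq_abs, ← Complex.norm_real, hswap]
  have hb : 0 < Real.pi * ‖ξ‖ ^ 2 := by have := Real.pi_pos; positivity
  have hgi := integrable_exp_neg_mul_sq hb
  have hge := integral_gaussian (Real.pi * ‖ξ‖ ^ 2)
  simp only [← neg_mul] at hgi hge
  calc ‖∫ v : ℝ, ∫ p : W, H (p, v)‖ ≤ ∫ v : ℝ, Real.exp (-Real.pi * ‖ξ‖ ^ 2 * v ^ 2) :=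
        norm_integral_le_of_norm_le hgi (Eventually.of_forall h2)
    _ = ‖ξ‖⁻¹ := by
        rw [hge, ← Real.sqrt_sq (inv_nonneg.2 hξ'.le)]
        congr 1
        have := Real.pi_pos
        field_simp

/-- Gaussian averages of a measure satisfying a Frostman condition. -/
lemma exists_lintegral_exp_neg_sq_dist_le {X : Type*} [PseudoMetricSpace X] [MeasurableSpace X]
    [OpensMeasurableSpace X] {ν : Measure X} {t : ℝ} (ht : 0 ≤ t) {C : ℝ≥0∞} (hC : C ≠ ⊤)
    (hν : ∀ x, ∀ r > 0, ν (Metric.closedBall x r) ≤ C * ENNReal.ofReal r ^ t) :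
    ∃ C' : ℝ≥0∞, C' ≠ ⊤ ∧ ∀ R > 0, ∀ p, ∫⁻ q, ENNReal.ofReal
      (Real.exp (-(Real.pi / 2) * R ^ 2 * dist q p ^ 2)) ∂ν ≤ C' * ENNReal.ofReal (R ^ (-t)) := by
  obtain ⟨N, hN⟩ := exists_nat_ge t
  have hsum : Summable fun k : ℕ => Real.exp (-(k : ℝ)) * ((k : ℝ) + 1) ^ t := by
    have h1 := Real.summable_pow_mul_exp_neg_nat_mul N one_pos
    have h2 := ((summable_nat_add_iff 1).2 h1).mul_left (Real.exp 1)
    refine Summable.of_nonneg_of_le (fun k => by positivity) (fun k => ?_) h2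
    have h3 : Real.exp (-(k : ℝ)) = Real.exp 1 * Real.exp (-1 * ((k + 1 : ℕ) : ℝ)) := by
      rw [← Real.exp_add]; congr 1; push_cast; ring
    have h4 : ((k : ℝ) + 1) ^ t ≤ ((k + 1 : ℕ) : ℝ) ^ N := by
      rw [← Real.rpow_natCast]
      push_cast
      exact Real.rpow_le_rpow_of_exponent_le (by linarith [Nat.cast_nonneg (α := ℝ) k]) hN
    rw [h3]
    calc _ ≤ Real.exp 1 * Real.exp (-1 * ((k + 1 : ℕ) : ℝ)) * ((k + 1 : ℕ) : ℝ) ^ N := by gcongr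
      _ = _ := by ring
  refine ⟨C * ENNReal.ofReal (∑' k : ℕ, Real.exp (-(k : ℝ)) * ((k : ℝ) + 1) ^ t),
    ENNReal.mul_ne_top hC ENNReal.ofReal_ne_top, fun R hR p => ?_⟩
  -- With `k` the integer part of `R · dist q p`, the Gaussian is at most `e^(-k)`, because `π/2 >
  -- 1` and `k ≤ k²`; the ball of index `k` contains `q`.
  have hpt : ∀ q, ENNReal.ofReal (Real.exp (-(Real.pi / 2) * R ^ 2 * dist q p ^ 2)) ≤
      ∑' k : ℕ, (Metric.closedBall p (((k : ℝ) + 1) / R)).indicator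
        (fun _ => ENNReal.ofReal (Real.exp (-(k : ℝ)))) q := by
    intro q
    set u := R * dist q p with hu
    have hu0 : 0 ≤ u := by positivity
    have hq : q ∈ Metric.closedBall p (((⌊u⌋₊ : ℝ) + 1) / R) := by
      rw [Metric.mem_closedBall, le_div_iff₀ hR, mul_comm]
      exact (Nat.lt_floor_add_one u).le
    refine le_trans ?_ (ENNReal.le_tsum ⌊u⌋₊)
    rw [indicator_of_mem hq]
    refine ENNReal.ofReal_le_ofReal (Real.exp_le_exp.2 ?_)
    have h1 : (⌊u⌋₊ : ℝ) ≤ u := Nat.floor_le hu0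
    have h2 : (⌊u⌋₊ : ℝ) ≤ (⌊u⌋₊ : ℝ) ^ 2 := by exact_mod_cast Nat.le_self_pow two_ne_zero _
    have h3 : (⌊u⌋₊ : ℝ) ^ 2 ≤ u ^ 2 := by gcongr
    have h4 : R ^ 2 * dist q p ^ 2 = u ^ 2 := by rw [hu]; ring
    have h5 := Real.pi_gt_three
    nlinarith [sq_nonneg u]
  refine (lintegral_mono hpt).trans ?_
  rw [lintegral_tsum fun k =>
    (measurable_const.indicator Metric.isClosed_closedBall.measurableSet).aemeasurable]
  have hterm : ∀ k : ℕ, ∫⁻ q, (Metric.closedBall p (((k : ℝ) + 1) / R)).indicator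
      (fun _ => ENNReal.ofReal (Real.exp (-(k : ℝ)))) q ∂ν ≤
      C * ENNReal.ofReal (R ^ (-t)) * ENNReal.ofReal (Real.exp (-(k : ℝ)) * ((k : ℝ) + 1) ^ t) := by
    intro k
    have hk : (0 : ℝ) < (k : ℝ) + 1 := by positivity
    rw [lintegral_indicator_const Metric.isClosed_closedBall.measurableSet]
    calc _ ≤ ENNReal.ofReal (Real.exp (-(k : ℝ))) *
          (C * ENNReal.ofReal (((k : ℝ) + 1) / R) ^ t) := by
          gcongr
          exact hν _ _ (by positivity)
      _ = _ := by
          rw [ENNReal.ofReal_rpow_of_nonneg (by positivity) ht, Real.div_rpow hk.le hR.le,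
            div_eq_mul_inv, ← Real.rpow_neg hR.le, ENNReal.ofReal_mul (by positivity),
            ENNReal.ofReal_mul (by positivity)]
          ring
  refine (ENNReal.tsum_le_tsum hterm).trans (le_of_eq ?_)
  rw [ENNReal.tsum_mul_left, ← ENNReal.ofReal_tsum_of_nonneg (fun k => by positivity) hsum]
  ring

/-- The Gaussian ridge in the direction `ξ` has small average for a measure satisfying a Frostman
condition. -/
lemma exists_lintegral_ridge_le {d : ℕ} {μ : Measure (EuclideanSpace ℝ (Fin d))} [SFinite μ]
    {s : ℝ} (hs : 0 ≤ s) {C : ℝ≥0∞} (hC : C ≠ ⊤)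
    (hμ : ∀ x, ∀ r > 0, μ (Metric.closedBall x r) ≤ C * ENNReal.ofReal r ^ s)
    {B : ℝ} (hB : ∀ᵐ x ∂μ, ‖x‖ ≤ B) :
    ∃ C' : ℝ≥0∞, C' ≠ ⊤ ∧ ∀ R ≥ 1, ∀ ξ : EuclideanSpace ℝ (Fin d), ξ ≠ 0 → ‖ξ‖ ≤ R → ∀ x,
      ∫⁻ y, ENNReal.ofReal (Real.exp (-2 * Real.pi * (inner ℝ ξ x - inner ℝ ξ y) ^ 2)) ∂μ ≤
        C' * ENNReal.ofReal (R ^ (d - s) * ‖ξ‖⁻¹) := by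
  set V := EuclideanSpace ℝ (Fin d)
  have hv0 : volume (Metric.closedBall (0 : V) 1) ≠ 0 :=
    (Metric.measure_closedBall_pos volume _ one_pos).ne'
  have hv1 : volume (Metric.closedBall (0 : V) 1) ≠ ⊤ := measure_closedBall_lt_top.ne
  -- The price of passing from `y` to a point `p` within `1/R`: since `|ξ·(p - y)| ≤ 1`, the ridge
  -- changes by at most `e^(2π)` once its exponent is halved, and the factor `e^(-π|p|²)` costs
  -- `e^(π(B+1)²)`.
  set K : ℝ := Real.exp (2 * Real.pi + Real.pi * (B + 1) ^ 2) with hK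
  refine ⟨(volume (Metric.closedBall (0 : V) 1))⁻¹ * ENNReal.ofReal K * C,
    ENNReal.mul_ne_top (ENNReal.mul_ne_top (ENNReal.inv_ne_top.2 hv0) ENNReal.ofReal_ne_top) hC,
    fun R hR ξ hξ hξR x => ?_⟩
  have hR0 : 0 < R := one_pos.trans_le hR
  let G : V → ℝ≥0∞ := fun p => ENNReal.ofReal
    (Real.exp (-Real.pi * (inner ℝ ξ p - inner ℝ ξ x) ^ 2) * Real.exp (-Real.pi * ‖p‖ ^ 2))
  have hG : Measurable G := by fun_prop
  have hpt : ∀ y, ‖y‖ ≤ B → ∀ p ∈ Metric.closedBall y R⁻¹,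
      Real.exp (-2 * Real.pi * (inner ℝ ξ x - inner ℝ ξ y) ^ 2) ≤
        K * (Real.exp (-Real.pi * (inner ℝ ξ p - inner ℝ ξ x) ^ 2) *
          Real.exp (-Real.pi * ‖p‖ ^ 2)) := by
    intro y hy p hp
    rw [hK, ← Real.exp_add, ← Real.exp_add]
    refine Real.exp_le_exp.2 ?_
    have hp' : ‖p - y‖ ≤ R⁻¹ := by simpa [dist_eq_norm] using hp
    have h1 : ‖p‖ ≤ B + 1 := by
      have : R⁻¹ ≤ 1 := inv_le_one_of_one_le₀ hR
      calc ‖p‖ = ‖y + (p - y)‖ := by congr 1; abel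
        _ ≤ ‖y‖ + ‖p - y‖ := norm_add_le _ _
        _ ≤ B + 1 := by linarith
    have h2 : |inner ℝ ξ (p - y)| ≤ 1 := by
      refine (abs_real_inner_le_norm _ _).trans ?_
      calc ‖ξ‖ * ‖p - y‖ ≤ R * R⁻¹ := by gcongr
        _ = 1 := mul_inv_cancel₀ hR0.ne'
    rw [inner_sub_right] at h2
    have h3 : (inner ℝ ξ p - inner ℝ ξ y) ^ 2 ≤ 1 := by rw [sq_le_one_iff_abs_le_one]; exact h2
    have h4 : ‖p‖ ^ 2 ≤ (B + 1) ^ 2 := by gcongr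
    have h5 : (inner ℝ ξ p - inner ℝ ξ x) ^ 2 ≤
        2 * (inner ℝ ξ x - inner ℝ ξ y) ^ 2 + 2 := by
      nlinarith [sq_nonneg (inner ℝ ξ p - inner ℝ ξ y + (inner ℝ ξ x - inner ℝ ξ y))]
    nlinarith [Real.pi_pos]
  have hvol : ∀ y : V, volume (Metric.closedBall y R⁻¹) =
      ENNReal.ofReal (R⁻¹ ^ d) * volume (Metric.closedBall (0 : V) 1) := by
    intro y
    rw [Measure.addHaar_closedBall' _ _ (by positivity)]
    simp [V]
  let A : Set (V × V) := {q | dist q.1 q.2 ≤ R⁻¹}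
  have hA : MeasurableSet A := (isClosed_le (by fun_prop) (by fun_prop)).measurableSet
  have hone : ∀ y, ‖y‖ ≤ B →
      ENNReal.ofReal (Real.exp (-2 * Real.pi * (inner ℝ ξ x - inner ℝ ξ y) ^ 2)) *
        (ENNReal.ofReal (R⁻¹ ^ d) * volume (Metric.closedBall (0 : V) 1)) ≤
      ENNReal.ofReal K * ∫⁻ p, A.indicator (fun q => G q.2) (y, p) := by
    intro y hy
    rw [← hvol y, ← setLIntegral_const, ← lintegral_const_mul' _ _ ENNReal.ofReal_ne_top,
      ← lintegral_indicator Metric.isClosed_closedBall.measurableSet]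
    refine lintegral_mono fun p => ?_
    by_cases hp : p ∈ Metric.closedBall y R⁻¹
    · have hpA : (y, p) ∈ A := by rw [Metric.mem_closedBall, dist_comm] at hp; exact hp
      rw [indicator_of_mem hp, indicator_of_mem hpA, ← ENNReal.ofReal_mul (by positivity)]
      exact ENNReal.ofReal_le_ofReal (hpt y hy p hp)
    · simp [indicator_of_notMem hp]
  have hAG : Measurable (A.indicator fun q : V × V => G q.2) :=
    (hG.comp measurable_snd).indicator hA
  have hinner : ∀ p, ∫⁻ y, A.indicator (fun q => G q.2) (y, p) ∂μ ≤
      G p * (C * ENNReal.ofReal (R ^ (-s))) := by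
    intro p
    have : ∀ y, A.indicator (fun q => G q.2) (y, p) =
        (Metric.closedBall p R⁻¹).indicator (fun _ => G p) y := fun y => by
      simp only [indicator, A, mem_ofPred_eq, Metric.mem_closedBall]
    simp only [this]
    rw [lintegral_indicator_const Metric.isClosed_closedBall.measurableSet]
    gcongr
    refine (hμ p R⁻¹ (by positivity)).trans (le_of_eq ?_)
    rw [ENNReal.ofReal_rpow_of_nonneg (by positivity) hs, Real.rpow_neg hR0.le, Real.inv_rpow hR0.le]
  -- Average over `p` in the ball about `y` and exchange the integrals. The `y`-integral is the mass
  -- of a ball of radius `1/R`, at most `C R^(-s)`, and Lebesgue measure sees the ridge with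
  -- integral at most `1/|ξ|`. Dividing by the volume of the ball produces `R^d`.
  have hmain : (∫⁻ y, ENNReal.ofReal
      (Real.exp (-2 * Real.pi * (inner ℝ ξ x - inner ℝ ξ y) ^ 2)) ∂μ) *
        (ENNReal.ofReal (R⁻¹ ^ d) * volume (Metric.closedBall (0 : V) 1)) ≤
      ENNReal.ofReal K * (ENNReal.ofReal ‖ξ‖⁻¹ * (C * ENNReal.ofReal (R ^ (-s)))) := by
    rw [← lintegral_mul_const' _ _ (ENNReal.mul_ne_top ENNReal.ofReal_ne_top hv1)]
    refine (lintegral_mono_ae (hB.mono hone)).trans ?_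
    rw [lintegral_const_mul' _ _ ENNReal.ofReal_ne_top]
    gcongr
    rw [lintegral_lintegral_swap (f := fun y p => A.indicator (fun q => G q.2) (y, p))
      hAG.aemeasurable]
    refine (lintegral_mono hinner).trans ?_
    rw [lintegral_mul_const _ hG]
    gcongr
    exact lintegral_gaussian_ridge_le hξ _
  have hRd : ENNReal.ofReal (R⁻¹ ^ d) ≠ 0 := by simp; positivity
  rw [← ENNReal.le_div_iff_mul_le (Or.inl (mul_ne_zero hRd hv0))
    (Or.inl (ENNReal.mul_ne_top ENNReal.ofReal_ne_top hv1))] at hmain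
  refine hmain.trans (le_of_eq ?_)
  rw [ENNReal.div_eq_inv_mul, ENNReal.mul_inv (Or.inl hRd) (Or.inl ENNReal.ofReal_ne_top),
    ← ENNReal.ofReal_inv_of_pos (by positivity), inv_pow, inv_inv, sub_eq_add_neg,
    Real.rpow_add hR0, Real.rpow_natCast, ENNReal.ofReal_mul (by positivity),
    ENNReal.ofReal_mul (by positivity)]
  ring

end Decay

/-! ### Weighted Cauchy–Schwarz. -/

section CauchySchwarz

lemma ofReal_norm_sq_integral_mul_le {α : Type*} [MeasurableSpace α] (κ : Measure α)
    {f g : α → ℂ} (hf : Measurable f) (hg : Measurable g)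
    {φ : α → ℝ} (hφ : Measurable φ) :
    ENNReal.ofReal (‖∫ t, f t * g t ∂κ‖ ^ 2) ≤
      (∫⁻ t, ENNReal.ofReal (‖f t‖ ^ 2 * Real.exp (φ t)) ∂κ) *
        ∫⁻ t, ENNReal.ofReal (‖g t‖ ^ 2 * Real.exp (-φ t)) ∂κ := by
  let F : α → ℝ≥0∞ := fun t => ENNReal.ofReal (‖f t‖ * Real.exp (φ t / 2))
  let G : α → ℝ≥0∞ := fun t => ENNReal.ofReal (‖g t‖ * Real.exp (-φ t / 2))
  have hF : Measurable F := by fun_prop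
  have hG : Measurable G := by fun_prop
  have hF2 : ∀ t, F t ^ (2 : ℝ) = ENNReal.ofReal (‖f t‖ ^ 2 * Real.exp (φ t)) := fun t => by
    simp only [F]
    rw [ENNReal.rpow_ofNat, ← ENNReal.ofReal_pow (by positivity), mul_pow, ← Real.exp_nat_mul]
    congr 3
    push_cast
    ring
  have hG2 : ∀ t, G t ^ (2 : ℝ) = ENNReal.ofReal (‖g t‖ ^ 2 * Real.exp (-φ t)) := fun t => by
    simp only [G]
    rw [ENNReal.rpow_ofNat, ← ENNReal.ofReal_pow (by positivity), mul_pow, ← Real.exp_nat_mul]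
    congr 3
    push_cast
    ring
  have hFG : ∀ t, ‖f t * g t‖ₑ = (F * G) t := fun t => by
    simp only [F, G, Pi.mul_apply]
    rw [← ENNReal.ofReal_mul (by positivity), ← ofReal_norm, norm_mul]
    congr 1
    rw [mul_mul_mul_comm, ← Real.exp_add]
    simp [neg_div]
  have h1 : ENNReal.ofReal ‖∫ t, f t * g t ∂κ‖ ≤ ∫⁻ t, (F * G) t ∂κ := by
    rw [ofReal_norm]
    refine (enorm_integral_le_lintegral_enorm _).trans (le_of_eq ?_)
    simp only [hFG]
  have h2 := ENNReal.lintegral_mul_le_Lp_mul_Lq κ Real.HolderConjugate.two_two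
    hF.aemeasurable hG.aemeasurable
  simp only [hF2, hG2] at h2
  rw [ENNReal.ofReal_pow (norm_nonneg _)]
  refine (pow_le_pow_left' (h1.trans h2) 2).trans (le_of_eq ?_)
  rw [mul_pow, ← ENNReal.rpow_natCast, ← ENNReal.rpow_natCast, ← ENNReal.rpow_mul,
    ← ENNReal.rpow_mul]
  norm_num

end CauchySchwarz

/-! ### Mean square decay of the transform of the image measure. -/

section Shell

variable {d : ℕ}

/-- The distribution of `r x + z` where `(z, r)` has distribution `ν` and `x` has
distribution `μ`. -/
def dilateTranslateMeasure (ν : Measure (EuclideanSpace ℝ (Fin d) × ℝ))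
    (μ : Measure (EuclideanSpace ℝ (Fin d))) : Measure (EuclideanSpace ℝ (Fin d)) :=
  (ν.prod μ).map fun q => dilateTranslate q.1 q.2

/-- The Fourier transform in the translation variable of `ν`, mollified at scale `R⁻¹` in the
dilation variable. -/
def translationFactor (ν : Measure (EuclideanSpace ℝ (Fin d) × ℝ)) (R : ℝ)
    (ξ : EuclideanSpace ℝ (Fin d)) (t : ℝ) : ℂ :=
  ∫ γ, (R * Real.exp (-Real.pi * R ^ 2 * (t - γ.2) ^ 2) : ℝ) *
    Complex.exp (-2 * Real.pi * Complex.I * (inner ℝ ξ γ.1 : ℝ)) ∂ν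

/-- The Fourier transform of `μ` along the ray through `ξ`, with a correction compensating the
mollification in `translationFactor`. -/
def dilationFactor (μ : Measure (EuclideanSpace ℝ (Fin d))) (R : ℝ)
    (ξ : EuclideanSpace ℝ (Fin d)) (t : ℝ) : ℂ :=
  ∫ x, (Real.exp (Real.pi / R ^ 2 * (inner ℝ ξ x) ^ 2) : ℝ) *
    Complex.exp (-2 * Real.pi * Complex.I * (inner ℝ t (inner ℝ ξ x) : ℝ)) ∂μ

variable {ν : Measure (EuclideanSpace ℝ (Fin d) × ℝ)} {μ : Measure (EuclideanSpace ℝ (Fin d))}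

lemma continuous_dilateTranslate :
    Continuous fun q : (EuclideanSpace ℝ (Fin d) × ℝ) × EuclideanSpace ℝ (Fin d) =>
      dilateTranslate q.1 q.2 := by
  unfold dilateTranslate
  fun_prop

lemma measurable_translationFactor [SFinite ν] (R : ℝ) :
    Measurable fun q : EuclideanSpace ℝ (Fin d) × ℝ => translationFactor ν R q.1 q.2 := by
  unfold translationFactor
  refine (StronglyMeasurable.integral_prod_right' (ν := ν) (f := fun q :
    (EuclideanSpace ℝ (Fin d) × ℝ) × (EuclideanSpace ℝ (Fin d) × ℝ) =>
    ((R * Real.exp (-Real.pi * R ^ 2 * (q.1.2 - q.2.2) ^ 2) : ℝ) : ℂ) *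
    Complex.exp (-2 * Real.pi * Complex.I * (inner ℝ q.1.1 q.2.1 : ℝ))) ?_).measurable
  exact Measurable.stronglyMeasurable (by fun_prop)

lemma measurable_dilationFactor [SFinite μ] (R : ℝ) (ξ : EuclideanSpace ℝ (Fin d)) :
    Measurable fun t => dilationFactor μ R ξ t := by
  unfold dilationFactor
  refine (StronglyMeasurable.integral_prod_right' (ν := μ) (f := fun q :
    ℝ × EuclideanSpace ℝ (Fin d) =>
    ((Real.exp (Real.pi / R ^ 2 * (inner ℝ ξ q.2) ^ 2) : ℝ) : ℂ) *
    Complex.exp (-2 * Real.pi * Complex.I * (inner ℝ q.1 (inner ℝ ξ q.2) : ℝ))) ?_).measurable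
  exact Measurable.stronglyMeasurable (by fun_prop)

/-- Gaussian mollification at scale `1/R` multiplies a character of frequency `u` by `e^(-πu²/R²)`,
exactly what the correction in `dilationFactor` undoes. -/
lemma integral_mollified_cexp {R : ℝ} (hR : 0 < R) (r u : ℝ) :
    ∫ t : ℝ, ((R * Real.exp (-Real.pi * R ^ 2 * (t - r) ^ 2) : ℝ) : ℂ) *
      Complex.exp (-2 * Real.pi * Complex.I * (inner ℝ t u : ℝ)) =
    ((Real.exp (-Real.pi / R ^ 2 * u ^ 2) : ℝ) : ℂ) *
      Complex.exp (-2 * Real.pi * Complex.I * (r * u : ℝ)) := by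
  rw [← integral_add_right_eq_self _ r]
  have h := integral_cexp_neg_two_pi_I_inner_mul_gaussian (W := ℝ) (b := R ^ 2) (by positivity) u
  have h1 : ∀ t : ℝ, ((R * Real.exp (-Real.pi * R ^ 2 * (t + r - r) ^ 2) : ℝ) : ℂ) *
      Complex.exp (-2 * Real.pi * Complex.I * (inner ℝ (t + r) u : ℝ)) =
      (R * Complex.exp (-2 * Real.pi * Complex.I * (r * u : ℝ))) *
        (Complex.exp (-2 * Real.pi * Complex.I * (inner ℝ t u : ℝ)) *
          (Real.exp (-Real.pi * R ^ 2 * ‖t‖ ^ 2) : ℝ)) := by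
    intro t
    rw [add_sub_cancel_right, Real.norm_eq_abs, sq_abs, inner_add_left,
      show inner ℝ r u = r * u by simp [mul_comm], Complex.ofReal_add, mul_add, Complex.exp_add]
    push_cast
    ring
  simp only [h1]
  rw [integral_const_mul, h]
  have h2 : ((R ^ 2)⁻¹ : ℝ) ^ (Module.finrank ℝ ℝ / 2 : ℝ) = R⁻¹ := by
    rw [← inv_pow, Module.finrank_self, ← Real.rpow_natCast, ← Real.rpow_mul (by positivity)]
    norm_num
  rw [h2, Real.norm_eq_abs, sq_abs]
  have hR' : (R : ℂ) ≠ 0 := by exact_mod_cast hR.ne'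
  push_cast
  field_simp

lemma integrable_exp_mul_inner_sq [IsFiniteMeasure μ] {B : ℝ} (hB : ∀ᵐ x ∂μ, ‖x‖ ≤ B) (c : ℝ)
    (hc : 0 ≤ c) (ξ : EuclideanSpace ℝ (Fin d)) :
    Integrable (fun x => Real.exp (c * (inner ℝ ξ x) ^ 2)) μ := by
  refine Integrable.of_bound (Continuous.aestronglyMeasurable (by fun_prop))
    (Real.exp (c * (‖ξ‖ * B) ^ 2)) ?_
  filter_upwards [hB] with x hx
  rw [Real.norm_eq_abs, Real.abs_exp]
  refine Real.exp_le_exp.2 (mul_le_mul_of_nonneg_left ?_ hc)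
  rw [← sq_abs]
  have : |inner ℝ ξ x| ≤ ‖ξ‖ * B := (abs_real_inner_le_norm _ _).trans (by gcongr)
  gcongr

/-- For fixed `γ` and `x` the `t`-integral reproduces the character at `r x + z`, the mollification
and the correction cancelling; the rest is Fubini. The bounded support of `μ` makes the growing
correction integrable. -/
lemma measureFourier_dilateTranslateMeasure [IsFiniteMeasure ν] [IsFiniteMeasure μ] {B : ℝ}
    (hB : ∀ᵐ x ∂μ, ‖x‖ ≤ B) {R : ℝ} (hR : 0 < R) (ξ : EuclideanSpace ℝ (Fin d)) :
    measureFourier (dilateTranslateMeasure ν μ) ξ =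
      ∫ t, translationFactor ν R ξ t * dilationFactor μ R ξ t := by
  let n : ℝ → (EuclideanSpace ℝ (Fin d) × ℝ) → ℂ := fun t γ =>
    ((R * Real.exp (-Real.pi * R ^ 2 * (t - γ.2) ^ 2) : ℝ) : ℂ) *
      Complex.exp (-2 * Real.pi * Complex.I * (inner ℝ ξ γ.1 : ℝ))
  let m : ℝ → EuclideanSpace ℝ (Fin d) → ℂ := fun t x =>
    ((Real.exp (Real.pi / R ^ 2 * (inner ℝ ξ x) ^ 2) : ℝ) : ℂ) *
      Complex.exp (-2 * Real.pi * Complex.I * (inner ℝ t (inner ℝ ξ x) : ℝ))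
  let H : ((EuclideanSpace ℝ (Fin d) × ℝ) × EuclideanSpace ℝ (Fin d)) × ℝ → ℂ :=
    fun q => n q.2 q.1.1 * m q.2 q.1.2
  have hHc : Continuous H := by fun_prop
  have hnorm : ∀ q, ‖H q‖ = Real.exp (Real.pi / R ^ 2 * (inner ℝ ξ q.1.2) ^ 2) *
      (R * Real.exp (-Real.pi * R ^ 2 * (q.2 - q.1.1.2) ^ 2)) := fun q => by
    simp only [H, n, m, norm_mul, norm_cexp_neg_two_pi_I_mul, Complex.norm_real, Real.norm_eq_abs,
      Real.abs_exp, abs_of_pos hR, mul_one]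
    ring
  have hg : Integrable fun t : ℝ => R * Real.exp (-Real.pi * R ^ 2 * t ^ 2) := by
    simpa using (integrable_exp_neg_mul_sq_norm (W := ℝ) (b := R ^ 2) (by positivity)).const_mul R
  have hH : Integrable H ((ν.prod μ).prod volume) := by
    rw [integrable_prod_iff hHc.aestronglyMeasurable]
    constructor
    · refine Eventually.of_forall fun p => ?_
      rw [← integrable_norm_iff (by fun_prop)]
      simp only [hnorm]
      exact (hg.comp_sub_right p.1.2).const_mul _
    · simp only [hnorm, integral_const_mul]
      have : ∀ r : ℝ, ∫ t : ℝ, R * Real.exp (-Real.pi * R ^ 2 * (t - r) ^ 2) =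
          ∫ t : ℝ, R * Real.exp (-Real.pi * R ^ 2 * t ^ 2) := fun r =>
        integral_sub_right_eq_self (fun t => R * Real.exp (-Real.pi * R ^ 2 * t ^ 2)) r
      simp only [← integral_const_mul, this]
      simp only [integral_const_mul]
      exact ((integrable_exp_mul_inner_sq hB _ (by have := Real.pi_pos; positivity) ξ).comp_snd
        ν).mul_const _
  have h1 : ∀ p : (EuclideanSpace ℝ (Fin d) × ℝ) × EuclideanSpace ℝ (Fin d),
      ∫ t, H (p, t) = Complex.exp (-2 * Real.pi * Complex.I *
        (inner ℝ ξ (dilateTranslate p.1 p.2) : ℝ)) := by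
    intro p
    have h3 : ∀ t, H (p, t) =
        (Complex.exp (-2 * Real.pi * Complex.I * (inner ℝ ξ p.1.1 : ℝ)) *
          (Real.exp (Real.pi / R ^ 2 * (inner ℝ ξ p.2) ^ 2) : ℝ)) *
        (((R * Real.exp (-Real.pi * R ^ 2 * (t - p.1.2) ^ 2) : ℝ) : ℂ) *
          Complex.exp (-2 * Real.pi * Complex.I * (inner ℝ t (inner ℝ ξ p.2) : ℝ))) := by
      intro t
      simp only [H, n, m]
      ring
    simp only [h3]
    rw [integral_const_mul, integral_mollified_cexp hR]
    have h4 : ((Real.exp (Real.pi / R ^ 2 * (inner ℝ ξ p.2) ^ 2) : ℝ) : ℂ) *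
        (Real.exp (-Real.pi / R ^ 2 * (inner ℝ ξ p.2) ^ 2) : ℝ) = 1 := by
      rw [← Complex.ofReal_mul, ← Real.exp_add, neg_div, neg_mul, add_neg_cancel, Real.exp_zero,
        Complex.ofReal_one]
    have h5 : Complex.exp (-2 * Real.pi * Complex.I * (inner ℝ ξ (dilateTranslate p.1 p.2) : ℝ)) =
        Complex.exp (-2 * Real.pi * Complex.I * (inner ℝ ξ p.1.1 : ℝ)) *
          Complex.exp (-2 * Real.pi * Complex.I * (p.1.2 * inner ℝ ξ p.2 : ℝ)) := by
      rw [← Complex.exp_add, dilateTranslate, inner_add_right, inner_smul_right]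
      congr 1
      push_cast
      ring
    rw [h5]
    linear_combination (Complex.exp (-2 * Real.pi * Complex.I * (inner ℝ ξ p.1.1 : ℝ)) *
      Complex.exp (-2 * Real.pi * Complex.I * (p.1.2 * inner ℝ ξ p.2 : ℝ))) * h4
  have h2 : ∀ t, ∫ p, H (p, t) ∂(ν.prod μ) = translationFactor ν R ξ t * dilationFactor μ R ξ t :=
    fun t => integral_prod_mul (n t) (m t)
  have hswap := integral_integral_swap (f := fun p t => H (p, t)) hH
  simp only [h1, h2] at hswap
  rw [← hswap, measureFourier, dilateTranslateMeasure,
    integral_map continuous_dilateTranslate.aemeasurable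
      (Continuous.aestronglyMeasurable (by fun_prop))]

/-- The left side is a Gaussian energy of the projection `x ↦ ξ·x`. As `|ξ·x| ≤ R B`, each
correction is at most `e^(πB²)`, and what remains is the average of a ridge. -/
lemma exists_lintegral_dilationFactor_le [IsProbabilityMeasure μ] {s : ℝ} (hs : 0 ≤ s) {C : ℝ≥0∞}
    (hC : C ≠ ⊤) (hμ : ∀ x, ∀ r > 0, μ (Metric.closedBall x r) ≤ C * ENNReal.ofReal r ^ s)
    {B : ℝ} (hB : ∀ᵐ x ∂μ, ‖x‖ ≤ B) :
    ∃ C' : ℝ≥0∞, C' ≠ ⊤ ∧ ∀ R ≥ 1, ∀ ξ : EuclideanSpace ℝ (Fin d), ξ ≠ 0 → ‖ξ‖ ≤ R →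
      ∫⁻ t, ENNReal.ofReal (‖dilationFactor μ R ξ t‖ ^ 2 *
        Real.exp (-Real.pi * (1 / 2) * ‖t‖ ^ 2)) ≤ C' * ENNReal.ofReal (R ^ (d - s) * ‖ξ‖⁻¹) := by
  obtain ⟨C₁, hC₁, hridge⟩ := exists_lintegral_ridge_le hs hC hμ hB
  set c : ℝ≥0∞ := ENNReal.ofReal ((1 / 2 : ℝ)⁻¹ ^ (Module.finrank ℝ ℝ / 2 : ℝ)) with hc
  refine ⟨c * (ENNReal.ofReal (Real.exp (2 * (Real.pi * B ^ 2))) * C₁),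
    ENNReal.mul_ne_top ENNReal.ofReal_ne_top (ENNReal.mul_ne_top ENNReal.ofReal_ne_top hC₁),
    fun R hR ξ hξ hξR => ?_⟩
  have hR0 : 0 < R := one_pos.trans_le hR
  unfold dilationFactor
  rw [lintegral_norm_sq_integral_mul_gaussian (W := ℝ) (κ := μ)
    (integrable_exp_mul_inner_sq hB _ (by have := Real.pi_pos; positivity) ξ)
    (fun y => (Real.exp_pos _).le) (L := fun x => inner ℝ ξ x) (by fun_prop)
    (b := 1 / 2) (by norm_num), ← hc, mul_assoc c]
  gcongr
  have hexp : ∀ x, ‖x‖ ≤ B → Real.exp (Real.pi / R ^ 2 * (inner ℝ ξ x) ^ 2) ≤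
      Real.exp (Real.pi * B ^ 2) := by
    intro x hx
    refine Real.exp_le_exp.2 ?_
    have h1 : |inner ℝ ξ x| ≤ R * B := (abs_real_inner_le_norm _ _).trans (by gcongr)
    have h2 : (inner ℝ ξ x) ^ 2 ≤ (R * B) ^ 2 := by rw [← sq_abs]; gcongr
    calc Real.pi / R ^ 2 * (inner ℝ ξ x) ^ 2 ≤ Real.pi / R ^ 2 * (R * B) ^ 2 := by
          have := Real.pi_pos
          gcongr
      _ = Real.pi * B ^ 2 := by field_simp
  have hone : ∀ x, ‖x‖ ≤ B → ∫⁻ y, ENNReal.ofReal (Real.exp (Real.pi / R ^ 2 * (inner ℝ ξ x) ^ 2) *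
      Real.exp (Real.pi / R ^ 2 * (inner ℝ ξ y) ^ 2) *
        Real.exp (-Real.pi / (1 / 2) * ‖inner ℝ ξ x - inner ℝ ξ y‖ ^ 2)) ∂μ ≤
      ENNReal.ofReal (Real.exp (2 * (Real.pi * B ^ 2))) * C₁ *
        ENNReal.ofReal (R ^ (d - s) * ‖ξ‖⁻¹) := by
    intro x hx
    rw [mul_assoc]
    refine le_trans ?_ (mul_le_mul_right (hridge R hR ξ hξ hξR x) _)
    rw [← lintegral_const_mul' _ _ ENNReal.ofReal_ne_top]
    refine lintegral_mono_ae ?_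
    filter_upwards [hB] with y hy
    rw [← ENNReal.ofReal_mul (by positivity)]
    refine ENNReal.ofReal_le_ofReal ?_
    rw [two_mul, Real.exp_add, Real.norm_eq_abs, sq_abs,
      show -Real.pi / (1 / 2) = -2 * Real.pi by ring]
    exact mul_le_mul_of_nonneg_right (mul_le_mul (hexp x hx) (hexp y hy) (by positivity)
      (by positivity)) (by positivity)
  refine (lintegral_mono_ae (hB.mono hone)).trans ?_
  simp

/-- With `v = t - (r + r')/2`, the two exponents add to `2v² + (r - r')²/2`. One `R²v²` is kept for
the later integration in `t`; the other absorbs the growing weight, because `t²/2 ≤ v² + B²` and `R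
≥ 1`. -/
lemma gaussian_product_le {R B r r' t z D : ℝ} (hR : 1 ≤ R) (hr : |r| ≤ B) (hr' : |r'| ≤ B)
    (hD : D ^ 2 ≤ 2 * z ^ 2 + (r - r') ^ 2) :
    Real.exp (Real.pi * (1 / 2) * t ^ 2) * (R * Real.exp (-Real.pi * R ^ 2 * (t - r) ^ 2) *
      (R * Real.exp (-Real.pi * R ^ 2 * (t - r') ^ 2)) * Real.exp (-Real.pi * R ^ 2 * z ^ 2)) ≤
    R ^ 2 * Real.exp (Real.pi * B ^ 2) * Real.exp (-(Real.pi / 2) * R ^ 2 * D ^ 2) *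
      Real.exp (-Real.pi * R ^ 2 * (t - (r + r') / 2) ^ 2) := by
  have h1 : Real.exp (Real.pi * (1 / 2) * t ^ 2) *
      (R * Real.exp (-Real.pi * R ^ 2 * (t - r) ^ 2) *
      (R * Real.exp (-Real.pi * R ^ 2 * (t - r') ^ 2)) * Real.exp (-Real.pi * R ^ 2 * z ^ 2)) =
      R ^ 2 * Real.exp (Real.pi * (1 / 2) * t ^ 2 + (-Real.pi * R ^ 2 * (t - r) ^ 2 +
        -Real.pi * R ^ 2 * (t - r') ^ 2 + -Real.pi * R ^ 2 * z ^ 2)) := by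
    rw [Real.exp_add, Real.exp_add, Real.exp_add]; ring
  have h0 : R ^ 2 * Real.exp (Real.pi * B ^ 2) * Real.exp (-(Real.pi / 2) * R ^ 2 * D ^ 2) *
      Real.exp (-Real.pi * R ^ 2 * (t - (r + r') / 2) ^ 2) =
      R ^ 2 * Real.exp (Real.pi * B ^ 2 + (-(Real.pi / 2) * R ^ 2 * D ^ 2 +
        -Real.pi * R ^ 2 * (t - (r + r') / 2) ^ 2)) := by
    rw [Real.exp_add, Real.exp_add]; ring
  rw [h0, h1]
  refine mul_le_mul_of_nonneg_left (Real.exp_le_exp.2 ?_) (sq_nonneg R)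
  set v := t - (r + r') / 2 with hv
  have hm : ((r + r') / 2) ^ 2 ≤ B ^ 2 := by
    rw [← sq_abs]
    have : |(r + r') / 2| ≤ B := by
      rw [abs_le] at *
      constructor <;> linarith [hr.1, hr.2, hr'.1, hr'.2]
    gcongr
  have h2 : t ^ 2 / 2 ≤ v ^ 2 + B ^ 2 := by
    have : v ^ 2 + ((r + r') / 2) ^ 2 - t ^ 2 / 2 = (v - (r + r') / 2) ^ 2 / 2 := by
      rw [hv]; ring
    linarith [sq_nonneg (v - (r + r') / 2)]
  have h3 : (t - r) ^ 2 + (t - r') ^ 2 = 2 * v ^ 2 + (r - r') ^ 2 / 2 := by rw [hv]; ring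
  have h4 : v ^ 2 ≤ R ^ 2 * v ^ 2 := le_mul_of_one_le_left (sq_nonneg v) (one_le_pow₀ hR)
  have h5 : R ^ 2 * D ^ 2 ≤ R ^ 2 * (2 * z ^ 2 + (r - r') ^ 2) := by gcongr
  have h6 : t ^ 2 / 2 - R ^ 2 * (2 * v ^ 2 + (r - r') ^ 2 / 2) - R ^ 2 * z ^ 2 ≤
      B ^ 2 - R ^ 2 * D ^ 2 / 2 - R ^ 2 * v ^ 2 := by linarith
  rw [← h3] at h6
  have := mul_le_mul_of_nonneg_left h6 Real.pi_pos.le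
  linarith

lemma lintegral_gaussian_product_le {R B : ℝ} (hR : 1 ≤ R)
    {γ γ' : EuclideanSpace ℝ (Fin d) × ℝ} (hγ : |γ.2| ≤ B) (hγ' : |γ'.2| ≤ B) :
    ∫⁻ t : ℝ, ENNReal.ofReal (Real.exp (Real.pi * (1 / 2) * t ^ 2) *
      (R * Real.exp (-Real.pi * R ^ 2 * (t - γ.2) ^ 2) *
        (R * Real.exp (-Real.pi * R ^ 2 * (t - γ'.2) ^ 2)) *
          Real.exp (-Real.pi * R ^ 2 * ‖γ.1 - γ'.1‖ ^ 2))) ≤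
    ENNReal.ofReal (R * Real.exp (Real.pi * B ^ 2)) *
      ENNReal.ofReal (Real.exp (-(Real.pi / 2) * R ^ 2 * dist γ' γ ^ 2)) := by
  have hR0 : 0 < R := one_pos.trans_le hR
  have hD : dist γ' γ ^ 2 ≤ 2 * ‖γ.1 - γ'.1‖ ^ 2 + (γ.2 - γ'.2) ^ 2 := by
    rw [dist_comm, Prod.dist_eq, dist_eq_norm, Real.dist_eq]
    rcases max_choice ‖γ.1 - γ'.1‖ |γ.2 - γ'.2| with h | h <;> rw [h]
    · nlinarith [sq_nonneg ‖γ.1 - γ'.1‖, sq_nonneg (γ.2 - γ'.2)]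
    · rw [sq_abs]; nlinarith [sq_nonneg ‖γ.1 - γ'.1‖]
  have hg : Integrable fun t : ℝ => Real.exp (-Real.pi * R ^ 2 * t ^ 2) := by
    simpa using integrable_exp_neg_mul_sq_norm (W := ℝ) (b := R ^ 2) (by positivity)
  have hgi : ∫ t : ℝ, Real.exp (-Real.pi * R ^ 2 * (t - (γ.2 + γ'.2) / 2) ^ 2) = R⁻¹ := by
    rw [integral_sub_right_eq_self (fun t => Real.exp (-Real.pi * R ^ 2 * t ^ 2))]
    have h := integral_gaussian (Real.pi * R ^ 2)
    simp only [← neg_mul] at h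
    rw [h, ← Real.sqrt_sq (inv_nonneg.2 hR0.le)]
    congr 1
    have := Real.pi_pos
    field_simp
  refine (lintegral_mono fun t => ENNReal.ofReal_le_ofReal
    (gaussian_product_le (t := t) hR hγ hγ' hD)).trans (le_of_eq ?_)
  rw [← ofReal_integral_eq_lintegral_ofReal ((hg.comp_sub_right _).const_mul _)
    (Eventually.of_forall fun t => by positivity), integral_const_mul, hgi,
    ← ENNReal.ofReal_mul (by positivity)]
  congr 1
  field_simp

/-- Integrating in `ξ` gives `R^d` and a Gaussian in `R(z - z')`; integrating the product of the two
bumps in `u` gives `R` and a Gaussian in `R(r - r')`. Together they detect the distance in the full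
parameter space at scale `1/R`, and the Frostman bound on `ν` contributes `R^(-t)`. -/
lemma exists_lintegral_translationFactor_le [IsProbabilityMeasure ν] {t : ℝ} (ht : 0 ≤ t)
    {C : ℝ≥0∞} (hC : C ≠ ⊤)
    (hν : ∀ x, ∀ r > 0, ν (Metric.closedBall x r) ≤ C * ENNReal.ofReal r ^ t)
    {B : ℝ} (hB : ∀ᵐ γ ∂ν, |γ.2| ≤ B) :
    ∃ C' : ℝ≥0∞, C' ≠ ⊤ ∧ ∀ R ≥ 1, ∫⁻ ξ : EuclideanSpace ℝ (Fin d), ∫⁻ u : ℝ,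
      ENNReal.ofReal (‖translationFactor ν R ξ u‖ ^ 2 * Real.exp (Real.pi * (1 / 2) * u ^ 2)) *
        ENNReal.ofReal (Real.exp (-Real.pi * (R ^ 2)⁻¹ * ‖ξ‖ ^ 2)) ≤
      C' * ENNReal.ofReal (R ^ (d + 1 - t)) := by
  obtain ⟨C₁, hC₁, hball⟩ := exists_lintegral_exp_neg_sq_dist_le ht hC hν
  refine ⟨ENNReal.ofReal (Real.exp (Real.pi * B ^ 2)) * C₁,
    ENNReal.mul_ne_top ENNReal.ofReal_ne_top hC₁, fun R hR => ?_⟩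
  have hR0 : 0 < R := one_pos.trans_le hR
  have hN := measurable_translationFactor (ν := ν) R
  rw [lintegral_lintegral_swap (by
    refine Measurable.aemeasurable ?_
    simp only [Function.uncurry_def]
    fun_prop)]
  let F : ℝ → (EuclideanSpace ℝ (Fin d) × ℝ) → (EuclideanSpace ℝ (Fin d) × ℝ) → ℝ≥0∞ :=
    fun u γ γ' => ENNReal.ofReal (Real.exp (Real.pi * (1 / 2) * u ^ 2) *
      (R * Real.exp (-Real.pi * R ^ 2 * (u - γ.2) ^ 2) *
        (R * Real.exp (-Real.pi * R ^ 2 * (u - γ'.2) ^ 2)) *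
          Real.exp (-Real.pi * R ^ 2 * ‖γ.1 - γ'.1‖ ^ 2)))
  have hF : Measurable fun q : (ℝ × (EuclideanSpace ℝ (Fin d) × ℝ)) ×
      (EuclideanSpace ℝ (Fin d) × ℝ) => F q.1.1 q.1.2 q.2 := by fun_prop
  have hinner : ∀ u : ℝ, ∫⁻ ξ : EuclideanSpace ℝ (Fin d),
      ENNReal.ofReal (‖translationFactor ν R ξ u‖ ^ 2 * Real.exp (Real.pi * (1 / 2) * u ^ 2)) *
        ENNReal.ofReal (Real.exp (-Real.pi * (R ^ 2)⁻¹ * ‖ξ‖ ^ 2)) =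
      ENNReal.ofReal (R ^ d) * ∫⁻ γ, ∫⁻ γ', F u γ γ' ∂ν ∂ν := by
    intro u
    have h1 : ∀ ξ : EuclideanSpace ℝ (Fin d),
        ENNReal.ofReal (‖translationFactor ν R ξ u‖ ^ 2 * Real.exp (Real.pi * (1 / 2) * u ^ 2)) *
          ENNReal.ofReal (Real.exp (-Real.pi * (R ^ 2)⁻¹ * ‖ξ‖ ^ 2)) =
        ENNReal.ofReal (Real.exp (Real.pi * (1 / 2) * u ^ 2)) *
          ENNReal.ofReal (‖translationFactor ν R ξ u‖ ^ 2 *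
            Real.exp (-Real.pi * (R ^ 2)⁻¹ * ‖ξ‖ ^ 2)) := fun ξ => by
      rw [← ENNReal.ofReal_mul (by positivity), ← ENNReal.ofReal_mul (by positivity)]
      congr 1
      ring
    simp only [h1]
    rw [lintegral_const_mul' _ _ ENNReal.ofReal_ne_top]
    unfold translationFactor
    rw [lintegral_norm_sq_integral_mul_gaussian (κ := ν)
      (a := fun γ => R * Real.exp (-Real.pi * R ^ 2 * (u - γ.2) ^ 2)) ?_
      (fun γ => by positivity) (L := fun γ => γ.1) measurable_fst (b := (R ^ 2)⁻¹) (by positivity)]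
    · have h2 : ((R ^ 2)⁻¹⁻¹ : ℝ) ^ (Module.finrank ℝ (EuclideanSpace ℝ (Fin d)) / 2 : ℝ) =
          R ^ d := by
        rw [inv_inv, finrank_euclideanSpace_fin, ← Real.rpow_natCast, ← Real.rpow_mul hR0.le,
          ← Real.rpow_natCast]
        congr 1
        push_cast
        ring
      rw [h2, mul_left_comm, ← lintegral_const_mul' _ _ ENNReal.ofReal_ne_top]
      congr 1
      refine lintegral_congr fun γ => ?_
      rw [← lintegral_const_mul' _ _ ENNReal.ofReal_ne_top]
      refine lintegral_congr fun γ' => ?_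
      rw [← ENNReal.ofReal_mul (by positivity), div_inv_eq_mul]
    · refine Integrable.of_bound (Continuous.aestronglyMeasurable (by fun_prop)) R
        (Eventually.of_forall fun γ => ?_)
      rw [Real.norm_eq_abs, abs_of_nonneg (by positivity)]
      refine mul_le_of_le_one_right hR0.le (Real.exp_le_one_iff.2 ?_)
      have : 0 ≤ Real.pi * R ^ 2 * (u - γ.2) ^ 2 := by have := Real.pi_pos; positivity
      linarith
  simp only [hinner]
  rw [lintegral_const_mul' _ _ ENNReal.ofReal_ne_top,
    lintegral_lintegral_swap hF.lintegral_prod_right'.aemeasurable]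
  have hone : ∀ γ, |γ.2| ≤ B → ∫⁻ u : ℝ, ∫⁻ γ', F u γ γ' ∂ν ∂volume ≤
      ENNReal.ofReal (R * Real.exp (Real.pi * B ^ 2)) * (C₁ * ENNReal.ofReal (R ^ (-t))) := by
    intro γ hγ
    rw [lintegral_lintegral_swap (by
      refine Measurable.aemeasurable ?_
      simp only [Function.uncurry_def]
      fun_prop)]
    refine le_trans ?_ (mul_le_mul_right (hball R hR0 γ) _)
    rw [← lintegral_const_mul' _ _ ENNReal.ofReal_ne_top]
    exact lintegral_mono_ae (hB.mono fun γ' hγ' => lintegral_gaussian_product_le hR hγ hγ')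
  calc ENNReal.ofReal (R ^ d) * ∫⁻ γ, ∫⁻ u : ℝ, ∫⁻ γ', F u γ γ' ∂ν ∂volume ∂ν
      ≤ ENNReal.ofReal (R ^ d) * (ENNReal.ofReal (R * Real.exp (Real.pi * B ^ 2)) *
          (C₁ * ENNReal.ofReal (R ^ (-t)))) := by
        gcongr
        refine (lintegral_mono_ae (hB.mono hone)).trans ?_
        simp
    _ = _ := by
        rw [sub_eq_add_neg, Real.rpow_add hR0, Real.rpow_add hR0, Real.rpow_one, Real.rpow_natCast,
          ENNReal.ofReal_mul (by positivity), ENNReal.ofReal_mul (by positivity),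
          ENNReal.ofReal_mul (by positivity)]
        ring

lemma measurable_measureFourier (σ : Measure (EuclideanSpace ℝ (Fin d))) [SFinite σ] :
    Measurable (measureFourier σ) := by
  unfold measureFourier
  refine (StronglyMeasurable.integral_prod_right' (ν := σ) (f := fun q :
    EuclideanSpace ℝ (Fin d) × EuclideanSpace ℝ (Fin d) =>
    Complex.exp (-2 * Real.pi * Complex.I * (inner ℝ q.1 q.2 : ℝ))) ?_).measurable
  exact Measurable.stronglyMeasurable (by fun_prop)

/-- The mean square decay of the Fourier transform on dyadic shells. -/
lemma exists_setLIntegral_shell_le [IsProbabilityMeasure ν] [IsProbabilityMeasure μ] {s t : ℝ}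
    (hs : 0 ≤ s) (ht : 0 ≤ t) {C₁ C₂ : ℝ≥0∞} (hC₁ : C₁ ≠ ⊤) (hC₂ : C₂ ≠ ⊤)
    (hμ : ∀ x, ∀ r > 0, μ (Metric.closedBall x r) ≤ C₁ * ENNReal.ofReal r ^ s)
    (hν : ∀ x, ∀ r > 0, ν (Metric.closedBall x r) ≤ C₂ * ENNReal.ofReal r ^ t)
    {B : ℝ} (hBμ : ∀ᵐ x ∂μ, ‖x‖ ≤ B) (hBν : ∀ᵐ γ ∂ν, |γ.2| ≤ B) :
    ∃ C : ℝ≥0∞, C ≠ ⊤ ∧ ∀ R ≥ 1, ∫⁻ ξ in {ξ | R / 2 ≤ ‖ξ‖ ∧ ‖ξ‖ ≤ R},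
      ENNReal.ofReal (‖measureFourier (dilateTranslateMeasure ν μ) ξ‖ ^ 2) ≤
        C * ENNReal.ofReal (R ^ (2 * d - s - t)) := by
  obtain ⟨A₁, hA₁, h1⟩ := exists_lintegral_dilationFactor_le hs hC₁ hμ hBμ
  obtain ⟨A₂, hA₂, h2⟩ := exists_lintegral_translationFactor_le ht hC₂ hν hBν
  refine ⟨A₁ * ENNReal.ofReal (2 * Real.exp Real.pi) * A₂,
    ENNReal.mul_ne_top (ENNReal.mul_ne_top hA₁ ENNReal.ofReal_ne_top) hA₂, fun R hR => ?_⟩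
  have hR0 : 0 < R := one_pos.trans_le hR
  let T : EuclideanSpace ℝ (Fin d) → ℝ≥0∞ := fun ξ => ∫⁻ u : ℝ,
    ENNReal.ofReal (‖translationFactor ν R ξ u‖ ^ 2 * Real.exp (Real.pi * (1 / 2) * u ^ 2)) *
      ENNReal.ofReal (Real.exp (-Real.pi * (R ^ 2)⁻¹ * ‖ξ‖ ^ 2))
  set c : ℝ≥0∞ := A₁ * ENNReal.ofReal (2 * Real.exp Real.pi) * ENNReal.ofReal (R ^ (d - s - 1))
    with hc
  have hct : c ≠ ⊤ := ENNReal.mul_ne_top (ENNReal.mul_ne_top hA₁ ENNReal.ofReal_ne_top)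
    ENNReal.ofReal_ne_top
  have hN := measurable_translationFactor (ν := ν) R
  have hpt : ∀ ξ ∈ {ξ : EuclideanSpace ℝ (Fin d) | R / 2 ≤ ‖ξ‖ ∧ ‖ξ‖ ≤ R},
      ENNReal.ofReal (‖measureFourier (dilateTranslateMeasure ν μ) ξ‖ ^ 2) ≤ c * T ξ := by
    rintro ξ ⟨hξ1, hξ2⟩
    have hξ0 : 0 < ‖ξ‖ := by linarith
    rw [measureFourier_dilateTranslateMeasure hBμ hR0]
    -- The growing weight goes to the translation factor, which decays like a Gaussian in `u`, and
    -- the decaying weight to the dilation factor, which need not decay.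
    refine (ofReal_norm_sq_integral_mul_le volume (hN.comp measurable_prodMk_left)
      (measurable_dilationFactor R ξ) (φ := fun u => Real.pi * (1 / 2) * u ^ 2)
      (by fun_prop)).trans ?_
    have h3 := h1 R hR ξ (norm_pos_iff.1 hξ0) hξ2
    simp only [Real.norm_eq_abs, sq_abs, neg_mul] at h3
    have h4 : T ξ = (∫⁻ u : ℝ, ENNReal.ofReal (‖translationFactor ν R ξ u‖ ^ 2 *
        Real.exp (Real.pi * (1 / 2) * u ^ 2))) *
        ENNReal.ofReal (Real.exp (-Real.pi * (R ^ 2)⁻¹ * ‖ξ‖ ^ 2)) :=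
      lintegral_mul_const' _ _ ENNReal.ofReal_ne_top
    have h5 : ‖ξ‖⁻¹ ≤ 2 * R⁻¹ := by
      rw [← div_eq_mul_inv, inv_le_comm₀ hξ0 (by positivity), inv_div]; exact hξ1
    -- On `‖ξ‖ ≤ R` the Gaussian cut-off in `ξ` can be inserted at the price `e^π`.
    have h6 : 1 ≤ Real.exp Real.pi * Real.exp (-Real.pi * (R ^ 2)⁻¹ * ‖ξ‖ ^ 2) := by
      rw [← Real.exp_add]
      refine Real.one_le_exp ?_
      have : (R ^ 2)⁻¹ * ‖ξ‖ ^ 2 ≤ 1 := by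
        rw [inv_mul_le_iff₀ (by positivity), mul_one]; gcongr
      nlinarith [Real.pi_pos]
    have h7 : R ^ ((d : ℝ) - s) * ‖ξ‖⁻¹ ≤ 2 * Real.exp Real.pi * R ^ ((d : ℝ) - s - 1) *
        Real.exp (-Real.pi * (R ^ 2)⁻¹ * ‖ξ‖ ^ 2) := by
      calc R ^ ((d : ℝ) - s) * ‖ξ‖⁻¹ ≤ R ^ ((d : ℝ) - s) * (2 * R⁻¹) * 1 := by
            rw [mul_one]; gcongr
        _ ≤ R ^ ((d : ℝ) - s) * (2 * R⁻¹) *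
            (Real.exp Real.pi * Real.exp (-Real.pi * (R ^ 2)⁻¹ * ‖ξ‖ ^ 2)) := by gcongr
        _ = _ := by
            rw [Real.rpow_sub_one hR0.ne']
            ring
    calc _ ≤ (∫⁻ u : ℝ, ENNReal.ofReal (‖translationFactor ν R ξ u‖ ^ 2 *
          Real.exp (Real.pi * (1 / 2) * u ^ 2))) *
          (c * ENNReal.ofReal (Real.exp (-Real.pi * (R ^ 2)⁻¹ * ‖ξ‖ ^ 2))) := by
          refine mul_le_mul' le_rfl ?_
          simp only [neg_mul]
          refine h3.trans ?_
          rw [hc, mul_assoc, mul_assoc]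
          refine mul_le_mul' le_rfl ?_
          rw [← ENNReal.ofReal_mul (by positivity), ← ENNReal.ofReal_mul (by positivity)]
          refine ENNReal.ofReal_le_ofReal (h7.trans (le_of_eq ?_))
          simp only [neg_mul]
          ring
      _ = c * T ξ := by rw [h4]; ring
  have hmeas : MeasurableSet {ξ : EuclideanSpace ℝ (Fin d) | R / 2 ≤ ‖ξ‖ ∧ ‖ξ‖ ≤ R} :=
    (measurableSet_le measurable_const measurable_norm).inter
      (measurableSet_le measurable_norm measurable_const)
  calc ∫⁻ ξ in {ξ | R / 2 ≤ ‖ξ‖ ∧ ‖ξ‖ ≤ R},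
      ENNReal.ofReal (‖measureFourier (dilateTranslateMeasure ν μ) ξ‖ ^ 2)
      ≤ ∫⁻ ξ in {ξ | R / 2 ≤ ‖ξ‖ ∧ ‖ξ‖ ≤ R}, c * T ξ := setLIntegral_mono' hmeas hpt
    _ ≤ ∫⁻ ξ, c * T ξ := setLIntegral_le_lintegral _ _
    _ = c * ∫⁻ ξ, T ξ := lintegral_const_mul' _ _ hct
    _ ≤ c * (A₂ * ENNReal.ofReal (R ^ (d + 1 - t))) := by gcongr; exact h2 R hR
    _ = _ := by
        have h : ENNReal.ofReal (R ^ (2 * (d : ℝ) - s - t)) =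
            ENNReal.ofReal (R ^ ((d : ℝ) - s - 1)) * ENNReal.ofReal (R ^ ((d : ℝ) + 1 - t)) := by
          rw [← ENNReal.ofReal_mul (by positivity), ← Real.rpow_add hR0]
          congr 2
          ring
        rw [hc, h]
        ring

end Shell

/-! ### Summation over dyadic shells. -/

section SobolevIntegral

variable {d : ℕ}

lemma norm_measureFourier_le_one (σ : Measure (EuclideanSpace ℝ (Fin d))) [IsProbabilityMeasure σ]
    (ξ : EuclideanSpace ℝ (Fin d)) : ‖measureFourier σ ξ‖ ≤ 1 := by
  refine (norm_integral_le_integral_norm _).trans ?_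
  simp [norm_cexp_neg_two_pi_I_mul, -neg_mul]

lemma rpow_le_two_rpow_abs_mul {x R : ℝ} (hR : 0 < R) (h1 : R / 2 ≤ x) (h2 : x ≤ 2 * R) (p : ℝ) :
    x ^ p ≤ 2 ^ |p| * R ^ p := by
  have hx : 0 < x := by linarith
  rcases le_total 0 p with hp | hp
  · rw [abs_of_nonneg hp, ← Real.mul_rpow (by norm_num) hR.le]
    gcongr
  · rw [abs_of_nonpos hp, Real.rpow_neg (by norm_num), ← Real.inv_rpow (by norm_num),
      ← Real.mul_rpow (by norm_num) hR.le]
    exact Real.rpow_le_rpow_of_nonpos (by positivity) (by linarith) hp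

/-- The shell `|ξ| ~ 2^j` contributes a constant times `2^(j(a-d+κ))`, a geometric series; on the
unit ball `|σ̂| ≤ 1` suffices. -/
lemma sobolevIntegral_lt_top_of_shell_bound {σ : Measure (EuclideanSpace ℝ (Fin d))}
    [IsProbabilityMeasure σ] {C : ℝ≥0∞} (hC : C ≠ ⊤) {κ : ℝ}
    (h : ∀ R ≥ 1, ∫⁻ ξ in {ξ | R / 2 ≤ ‖ξ‖ ∧ ‖ξ‖ ≤ R},
      ENNReal.ofReal (‖measureFourier σ ξ‖ ^ 2) ≤ C * ENNReal.ofReal (R ^ κ))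
    {a : ℝ} (ha : a - d + κ < 0) : sobolevIntegral σ a < ⊤ := by
  let f : EuclideanSpace ℝ (Fin d) → ℝ≥0∞ := fun ξ =>
    ENNReal.ofReal (‖measureFourier σ ξ‖ ^ 2 * (1 + ‖ξ‖) ^ (a - d))
  let A : ℕ → Set (EuclideanSpace ℝ (Fin d)) := fun j =>
    {ξ | (2 : ℝ) ^ (j + 1) / 2 ≤ ‖ξ‖ ∧ ‖ξ‖ ≤ 2 ^ (j + 1)}
  have hA : ∀ j, MeasurableSet (A j) := fun j =>
    (measurableSet_le measurable_const measurable_norm).inter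
      (measurableSet_le measurable_norm measurable_const)
  have hcov : (univ : Set (EuclideanSpace ℝ (Fin d))) ⊆ Metric.closedBall 0 1 ∪ ⋃ j, A j := by
    intro ξ _
    rcases le_or_gt ‖ξ‖ 1 with hξ | hξ
    · left; simpa using hξ
    · right
      obtain ⟨j, hj1, hj2⟩ := exists_nat_pow_near hξ.le (one_lt_two (α := ℝ))
      refine mem_iUnion.2 ⟨j, ?_, hj2.le⟩
      rw [pow_succ, mul_div_cancel_right₀ _ two_ne_zero]
      exact hj1
  have hball : ∫⁻ ξ in Metric.closedBall 0 1, f ξ < ⊤ := by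
    have : ∀ ξ ∈ Metric.closedBall (0 : EuclideanSpace ℝ (Fin d)) 1,
        f ξ ≤ ENNReal.ofReal (2 ^ |a - d|) := by
      intro ξ hξ
      have hξ' : ‖ξ‖ ≤ 1 := by simpa using hξ
      refine ENNReal.ofReal_le_ofReal ?_
      have h1 := rpow_le_two_rpow_abs_mul (x := 1 + ‖ξ‖) one_pos
        (by linarith [norm_nonneg ξ]) (by linarith) (a - d)
      have h2 : ‖measureFourier σ ξ‖ ^ 2 ≤ 1 := pow_le_one₀ (norm_nonneg _)
        (norm_measureFourier_le_one σ ξ)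
      rw [Real.one_rpow, mul_one] at h1
      calc _ ≤ 1 * (2 : ℝ) ^ |a - d| := by gcongr
        _ = _ := one_mul _
    refine (setLIntegral_mono' Metric.isClosed_closedBall.measurableSet this).trans_lt ?_
    rw [setLIntegral_const]
    exact ENNReal.mul_lt_top ENNReal.ofReal_lt_top measure_closedBall_lt_top
  have hshell : ∀ j, ∫⁻ ξ in A j, f ξ ≤
      ENNReal.ofReal (2 ^ |a - d|) * C * ENNReal.ofReal (2 ^ (a - d + κ)) ^ (j + 1) := by
    intro j
    set R : ℝ := 2 ^ (j + 1) with hR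
    have hR1 : 1 ≤ R := one_le_pow₀ (by norm_num)
    have hR0 : 0 < R := by positivity
    have hpt : ∀ ξ ∈ A j, f ξ ≤ ENNReal.ofReal (2 ^ |a - d| * R ^ (a - d)) *
        ENNReal.ofReal (‖measureFourier σ ξ‖ ^ 2) := by
      rintro ξ ⟨h1, h2⟩
      rw [← ENNReal.ofReal_mul (by positivity)]
      refine ENNReal.ofReal_le_ofReal ?_
      rw [mul_comm]
      gcongr
      exact rpow_le_two_rpow_abs_mul hR0 (by linarith) (by linarith) _
    refine (setLIntegral_mono' (hA j) hpt).trans ?_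
    rw [lintegral_const_mul' _ _ ENNReal.ofReal_ne_top]
    refine (mul_le_mul' le_rfl (h R hR1)).trans (le_of_eq ?_)
    have h3 : ENNReal.ofReal (2 ^ (a - d + κ)) ^ (j + 1) =
        ENNReal.ofReal (R ^ (a - d)) * ENNReal.ofReal (R ^ κ) := by
      rw [← ENNReal.ofReal_pow (by positivity), ← ENNReal.ofReal_mul (by positivity),
        ← Real.rpow_add hR0, hR, ← Real.rpow_natCast, ← Real.rpow_natCast, ← Real.rpow_mul
        (by norm_num), ← Real.rpow_mul (by norm_num), mul_comm]
    rw [h3, ENNReal.ofReal_mul (by positivity)]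
    ring
  have hq : ENNReal.ofReal (2 ^ (a - d + κ)) < 1 := by
    rw [ENNReal.ofReal_lt_one]
    exact Real.rpow_lt_one_of_one_lt_of_neg (by norm_num) ha
  calc sobolevIntegral σ a = ∫⁻ ξ in univ, f ξ := by rw [setLIntegral_univ]; rfl
    _ ≤ ∫⁻ ξ in Metric.closedBall 0 1 ∪ ⋃ j, A j, f ξ := lintegral_mono_set hcov
    _ ≤ (∫⁻ ξ in Metric.closedBall 0 1, f ξ) + ∑' j, ∫⁻ ξ in A j, f ξ :=
        (lintegral_union_le _ _ _).trans (add_le_add le_rfl (lintegral_iUnion_le _ _))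
    _ ≤ (∫⁻ ξ in Metric.closedBall 0 1, f ξ) +
        ∑' j : ℕ, ENNReal.ofReal (2 ^ |a - d|) * C * ENNReal.ofReal (2 ^ (a - d + κ)) ^ (j + 1) :=
        add_le_add le_rfl (ENNReal.tsum_le_tsum hshell)
    _ < ⊤ := by
        refine ENNReal.add_lt_top.2 ⟨hball, ?_⟩
        rw [ENNReal.tsum_mul_left]
        refine ENNReal.mul_lt_top (ENNReal.mul_lt_top ENNReal.ofReal_lt_top hC.lt_top) ?_
        simp only [pow_succ]
        rw [ENNReal.tsum_mul_right, ENNReal.tsum_geometric]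
        refine ENNReal.mul_lt_top ?_ ENNReal.ofReal_lt_top
        exact ENNReal.inv_lt_top.2 (tsub_pos_of_lt hq)

/-- The set `Γ(E)` carries measures whose Fourier transform decays in mean square according to the
Hausdorff dimensions of `E` and `Γ`. -/
theorem exists_isCarriedBy_sobolevIntegral_lt_top {E : Set (EuclideanSpace ℝ (Fin d))}
    (hE : MeasurableSet E) (hEne : E.Nonempty) {Γ : Set (EuclideanSpace ℝ (Fin d) × ℝ)}
    (hΓ : MeasurableSet Γ) (hΓne : Γ.Nonempty) {a : ℝ}
    (ha : a < (dimH E).toReal + (dimH Γ).toReal - d) :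
    ∃ σ, IsCarriedBy σ (dilateTranslateSet Γ E) ∧ sobolevIntegral σ a < ⊤ := by
  -- Half the available gap is spent on each measure: `s + t > a + d`, which makes `a - d + (2d - s
  -- - t)` negative.
  set δ := ((dimH E).toReal + (dimH Γ).toReal - d - a) / 2 with hδ
  have hδ0 : 0 < δ := by linarith
  obtain ⟨s, hs0, hs, K, hKE, hK, μ, hμp, hμK, C₁, hC₁, hμ⟩ :=
    exists_frostman_measure_of_nonempty hE hEne (b := (dimH E).toReal - δ) (by linarith)
  obtain ⟨t, ht0, ht, L, hLΓ, hL, ν, hνp, hνL, C₂, hC₂, hν⟩ :=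
    exists_frostman_measure_of_nonempty hΓ hΓne (b := (dimH Γ).toReal - δ) (by linarith)
  obtain ⟨B₁, hB₁⟩ := hK.isBounded.exists_norm_le
  obtain ⟨B₂, hB₂⟩ := hL.isBounded.exists_norm_le
  have hBμ : ∀ᵐ x ∂μ, ‖x‖ ≤ max B₁ B₂ := by
    have : ∀ᵐ x ∂μ, x ∈ K := hμK
    exact this.mono fun x hx => (hB₁ x hx).trans (le_max_left _ _)
  have hBν : ∀ᵐ γ ∂ν, |γ.2| ≤ max B₁ B₂ := by
    have : ∀ᵐ x ∂ν, x ∈ L := hνL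
    exact this.mono fun γ hγ => (norm_snd_le γ).trans ((hB₂ γ hγ).trans (le_max_right _ _))
  obtain ⟨C, hC, hshell⟩ := exists_setLIntegral_shell_le hs0 ht0 hC₁ hC₂ hμ hν hBμ hBν
  have hprob : IsProbabilityMeasure (dilateTranslateMeasure ν μ) :=
    Measure.isProbabilityMeasure_map continuous_dilateTranslate.aemeasurable
  have himg : IsCompact ((fun q : (EuclideanSpace ℝ (Fin d) × ℝ) × EuclideanSpace ℝ (Fin d) =>
      dilateTranslate q.1 q.2) '' (L ×ˢ K)) := (hL.prod hK).image continuous_dilateTranslate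
  refine ⟨dilateTranslateMeasure ν μ, ⟨hprob, _, himg, ?_, ?_⟩,
    sobolevIntegral_lt_top_of_shell_bound hC hshell (by linarith)⟩
  · rintro _ ⟨⟨γ, x⟩, ⟨hγ, hx⟩, rfl⟩
    exact ⟨γ, hLΓ hγ, x, hKE hx, rfl⟩
  · rw [dilateTranslateMeasure, Measure.map_apply continuous_dilateTranslate.measurable
      himg.measurableSet.compl]
    refine measure_mono_null (t := (Lᶜ ×ˢ univ) ∪ (univ ×ˢ Kᶜ)) (fun q hq => ?_)
      (measure_union_null (by rw [Measure.prod_prod, hνL, zero_mul])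
        (by rw [Measure.prod_prod, hμK, mul_zero]))
    rw [← compl_prod_eq_union]
    exact fun hq' => hq (mem_image_of_mem _ hq')

end SobolevIntegral

/-! ### Square integrable transforms and positive volume. -/

section AbsolutelyContinuous

open scoped FourierTransform SchwartzMap

variable {d : ℕ}

/-- Parseval's formula against a measure: Fourier inversion for `f`, then Fubini. -/
lemma integral_schwartzMap_eq_integral_fourier_mul {σ : Measure (EuclideanSpace ℝ (Fin d))}
    [IsFiniteMeasure σ] (f : 𝓢(EuclideanSpace ℝ (Fin d), ℂ)) :
    ∫ x, f x ∂σ = ∫ ξ, 𝓕 f ξ * (starRingEnd ℂ) (measureFourier σ ξ) := by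
  let H : EuclideanSpace ℝ (Fin d) × EuclideanSpace ℝ (Fin d) → ℂ := fun q =>
    Complex.exp (-2 * Real.pi * Complex.I * ((-inner ℝ q.2 q.1 : ℝ) : ℝ)) * 𝓕 f q.2
  have hH : Integrable H (σ.prod volume) := by
    refine ((𝓕 f).integrable.comp_snd σ).mono ?_ (Eventually.of_forall fun q => ?_)
    · have := (𝓕 f).continuous
      exact Continuous.aestronglyMeasurable (by fun_prop)
    · simp only [H, norm_mul, norm_cexp_neg_two_pi_I_mul, one_mul, le_refl]
  have h1 : ∀ x, ∫ ξ, H (x, ξ) = f x := by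
    intro x
    have h2 : f x = (FourierTransformInv.fourierInv (𝓕 f) : 𝓢(EuclideanSpace ℝ (Fin d), ℂ)) x := by
      rw [FourierTransform.fourierInv_fourier_eq (F := 𝓢(EuclideanSpace ℝ (Fin d), ℂ))]
    rw [h2, SchwartzMap.fourierInv_coe, Real.fourierInv_eq']
    refine integral_congr_ae (Eventually.of_forall fun ξ => ?_)
    simp only [H, smul_eq_mul]
    congr 2
    push_cast
    ring
  have h3 : ∀ ξ, ∫ x, H (x, ξ) ∂σ = 𝓕 f ξ * (starRingEnd ℂ) (measureFourier σ ξ) := by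
    intro ξ
    rw [measureFourier, ← integral_conj, mul_comm, ← integral_mul_const]
    simp only [H, conj_cexp_neg_two_pi_I_mul]
  have := integral_integral_swap (f := fun x ξ => H (x, ξ)) hH
  simpa only [h1, h3] using this

lemma lintegral_norm_sq_fourier_schwartzMap (f : 𝓢(EuclideanSpace ℝ (Fin d), ℂ)) :
    ∫⁻ ξ, ENNReal.ofReal (‖𝓕 f ξ‖ ^ 2) = ∫⁻ x, ENNReal.ofReal (‖f x‖ ^ 2) := by
  have hint : ∀ g : 𝓢(EuclideanSpace ℝ (Fin d), ℂ), Integrable fun x => ‖g x‖ ^ 2 := fun g =>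
    (memLp_two_iff_integrable_sq_norm g.continuous.aestronglyMeasurable).1 (g.memLp 2)
  rw [← ofReal_integral_eq_lintegral_ofReal (hint _) (Eventually.of_forall fun _ => by positivity),
    ← ofReal_integral_eq_lintegral_ofReal (hint _) (Eventually.of_forall fun _ => by positivity),
    SchwartzMap.integral_norm_sq_fourier]

lemma exists_schwartzMap_one_on {K U : Set (EuclideanSpace ℝ (Fin d))} (hK : IsCompact K)
    (hU : IsOpen U) (hKU : K ⊆ U) : ∃ f : 𝓢(EuclideanSpace ℝ (Fin d), ℂ), (∀ x ∈ K, f x = 1) ∧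
      (∀ x, ‖f x‖ ≤ 1) ∧ ∀ x ∉ U, f x = 0 := by
  obtain ⟨B, hB⟩ := hK.isBounded.exists_norm_le
  let O := U ∩ Metric.ball (0 : EuclideanSpace ℝ (Fin d)) (B + 1)
  have hO : IsOpen O := hU.inter Metric.isOpen_ball
  have hKO : K ⊆ O := fun x hx => ⟨hKU hx, by
    rw [mem_ball_zero_iff]; linarith [hB x hx]⟩
  obtain ⟨φ, hφ, hrange, h0, h1⟩ := exists_contMDiff_zero_iff_one_iff_of_isClosed
    (n := (⊤ : ℕ∞)) (modelWithCornersSelf ℝ (EuclideanSpace ℝ (Fin d))) hO.isClosed_compl hK.isClosed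
    (disjoint_compl_left_iff_subset.2 hKO)
  have hφ' : ContDiff ℝ (⊤ : ℕ∞) φ := contMDiff_iff_contDiff.1 hφ
  have hsupp : HasCompactSupport φ := by
    refine HasCompactSupport.of_support_subset_isCompact
      (isCompact_closedBall (0 : EuclideanSpace ℝ (Fin d)) (B + 1)) fun x hx => ?_
    have : x ∈ O := by
      by_contra hxO
      exact hx ((h0 x).1 hxO)
    exact Metric.ball_subset_closedBall this.2
  have hsupp' : HasCompactSupport (Complex.ofRealCLM ∘ φ) := hsupp.comp_left rfl
  refine ⟨hsupp'.toSchwartzMap (Complex.ofRealCLM.contDiff.comp hφ'), fun x hx => ?_, fun x => ?_,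
    fun x hx => ?_⟩
  · simp [(h1 x).1 hx]
  · have := hrange (mem_range_self x)
    simp [abs_of_nonneg this.1, this.2]
  · simp [(h0 x).1 fun hxO => hx hxO.1]

/-- A compact set carrying a probability measure with square integrable Fourier transform has
positive volume. -/
lemma volume_pos_of_lintegral_norm_sq_measureFourier_lt_top
    {σ : Measure (EuclideanSpace ℝ (Fin d))} [IsProbabilityMeasure σ]
    {K : Set (EuclideanSpace ℝ (Fin d))} (hK : IsCompact K) (hσK : σ Kᶜ = 0)
    (hσ : ∫⁻ ξ, ENNReal.ofReal (‖measureFourier σ ξ‖ ^ 2) < ⊤) : 0 < volume K := by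
  set Q := ∫⁻ ξ, ENNReal.ofReal (‖measureFourier σ ξ‖ ^ 2) with hQ
  by_contra! h0
  have hae : ∀ᵐ x ∂σ, x ∈ K := hσK
  -- A null `K` has neighbourhoods `U` of volume below `ε`. For a cut-off `f` between `K` and `U`,
  -- Parseval, Cauchy–Schwarz and Plancherel give `1 = |∫ f dσ|² ≤ ‖f‖₂² Q ≤ ε Q`.
  have hle : ∀ ε : ℝ≥0∞, 0 < ε → 1 ≤ ε * Q := by
    intro ε hε
    obtain ⟨U, hKU, hU, hvol⟩ := K.exists_isOpen_lt_of_lt ε (h0.trans_lt hε)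
    obtain ⟨f, h1, h2, h3⟩ := exists_schwartzMap_one_on hK hU hKU
    have hone : ∫ x, f x ∂σ = 1 := by
      rw [integral_congr_ae (hae.mono fun x hx => h1 x hx)]
      simp
    have hcs := ofReal_norm_sq_integral_mul_le volume (f := fun ξ => 𝓕 f ξ)
      (g := fun ξ => (starRingEnd ℂ) (measureFourier σ ξ)) (𝓕 f).continuous.measurable
      (Complex.continuous_conj.measurable.comp (measurable_measureFourier σ))
      (φ := fun _ => 0) measurable_const
    rw [← integral_schwartzMap_eq_integral_fourier_mul, hone] at hcs
    simp only [norm_one, one_pow, ENNReal.ofReal_one, neg_zero, Real.exp_zero, mul_one,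
      RCLike.norm_conj, lintegral_norm_sq_fourier_schwartzMap] at hcs
    refine hcs.trans ?_
    gcongr
    calc ∫⁻ x, ENNReal.ofReal (‖f x‖ ^ 2) ≤ ∫⁻ x, U.indicator 1 x := by
          refine lintegral_mono fun x => ?_
          by_cases hx : x ∈ U
          · rw [indicator_of_mem hx]
            exact ENNReal.ofReal_le_one.2 (pow_le_one₀ (norm_nonneg _) (h2 x))
          · simp [h3 x hx]
      _ = volume U := lintegral_indicator_one hU.measurableSet
      _ ≤ ε := hvol.le
  have := ENNReal.exists_pos_mul_lt (a := Q) (b := 1) hσ.ne one_ne_zero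
  obtain ⟨ε, hε, hlt⟩ := this
  exact absurd (hle ε hε) (not_le.2 hlt)

end AbsolutelyContinuous

/-! ### From Sobolev integrals to Hausdorff dimension. -/

section Energy

variable {d : ℕ}

/-- The indicator of `|x - y| ≤ 1/R` is at most `e^π e^(-πR²|x-y|²)`, whose double integral is `e^π
R^(-d)` times the integral of `|σ̂|²` against `e^(-π|ξ|²/R²)`. That weight is dominated by `R^(d-b)
(1+|ξ|)^(b-d)` up to a constant, as `b ≤ d`. -/
lemma exists_lintegral_measure_closedBall_le {σ : Measure (EuclideanSpace ℝ (Fin d))}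
    [IsProbabilityMeasure σ] {b : ℝ} (hb : b ≤ d) (hσ : sobolevIntegral σ b < ⊤) :
    ∃ C : ℝ≥0∞, C ≠ ⊤ ∧ ∀ R ≥ 1,
      ∫⁻ x, σ (Metric.closedBall x R⁻¹) ∂σ ≤ C * ENNReal.ofReal (R ^ (-b)) := by
  set p : ℝ := d - b with hp
  have hp0 : 0 ≤ p := by linarith
  refine ⟨ENNReal.ofReal (Real.exp Real.pi * Real.exp (p ^ 2)) * sobolevIntegral σ b,
    ENNReal.mul_ne_top ENNReal.ofReal_ne_top hσ.ne, fun R hR => ?_⟩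
  have hR0 : 0 < R := one_pos.trans_le hR
  have hG := lintegral_norm_sq_integral_mul_gaussian (κ := σ) (a := fun _ => 1)
    (integrable_const _) (fun _ => zero_le_one) (L := fun x => x) measurable_id
    (b := (R ^ 2)⁻¹) (by positivity)
  have hRd : ((R ^ 2)⁻¹⁻¹ : ℝ) ^ (Module.finrank ℝ (EuclideanSpace ℝ (Fin d)) / 2 : ℝ) =
      R ^ d := by
    rw [inv_inv, finrank_euclideanSpace_fin, ← Real.rpow_natCast, ← Real.rpow_mul hR0.le,
      ← Real.rpow_natCast]
    congr 1
    push_cast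
    ring
  simp only [Complex.ofReal_one, one_mul, hRd, div_inv_eq_mul] at hG
  -- With `v = ‖t‖ / R` one has `1 + ‖t‖ ≤ R e^v`, and `v p - πv² ≤ p²` yields the constant.
  have hgauss : ∀ t : EuclideanSpace ℝ (Fin d), Real.exp (-Real.pi * (R ^ 2)⁻¹ * ‖t‖ ^ 2) ≤
      Real.exp (p ^ 2) * R ^ p * (1 + ‖t‖) ^ (b - d) := by
    intro t
    set v := ‖t‖ / R with hv
    have hv0 : 0 ≤ v := by positivity
    have h1 : 1 + ‖t‖ ≤ R * Real.exp v := by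
      have h2 : v + 1 ≤ Real.exp v := Real.add_one_le_exp v
      have h3 : R * v = ‖t‖ := by rw [hv]; field_simp
      calc 1 + ‖t‖ ≤ R * (v + 1) := by rw [mul_add, h3]; linarith
        _ ≤ _ := by gcongr
    have h4 : (1 + ‖t‖) ^ p ≤ R ^ p * Real.exp (v * p) := by
      rw [Real.exp_mul, ← Real.mul_rpow hR0.le (Real.exp_pos v).le]
      gcongr
    have h5 : (1 + ‖t‖) ^ (b - d) = ((1 + ‖t‖) ^ p)⁻¹ := by
      rw [← Real.rpow_neg (by positivity)]; congr 1; rw [hp]; ring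
    rw [h5, le_mul_inv_iff₀ (by positivity)]
    have h6 : -Real.pi * (R ^ 2)⁻¹ * ‖t‖ ^ 2 = -(Real.pi * v ^ 2) := by
      rw [hv]; field_simp
    calc _ ≤ Real.exp (-(Real.pi * v ^ 2)) * (R ^ p * Real.exp (v * p)) := by
          rw [h6]; gcongr
      _ = Real.exp (-(Real.pi * v ^ 2) + v * p) * R ^ p := by rw [Real.exp_add]; ring
      _ ≤ _ := by
          gcongr
          nlinarith [Real.pi_gt_three, sq_nonneg (v - p), sq_nonneg v, sq_nonneg p]
  have hle : ENNReal.ofReal (R ^ d) * ∫⁻ x, ∫⁻ y, ENNReal.ofReal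
      (Real.exp (-Real.pi * R ^ 2 * ‖x - y‖ ^ 2)) ∂σ ∂σ ≤
      ENNReal.ofReal (Real.exp (p ^ 2) * R ^ p) * sobolevIntegral σ b := by
    rw [← hG, sobolevIntegral, ← lintegral_const_mul' _ _ ENNReal.ofReal_ne_top]
    refine lintegral_mono fun t => ?_
    rw [← ENNReal.ofReal_mul (by positivity)]
    refine ENNReal.ofReal_le_ofReal ?_
    calc _ ≤ ‖measureFourier σ t‖ ^ 2 * (Real.exp (p ^ 2) * R ^ p * (1 + ‖t‖) ^ (b - d)) :=
          mul_le_mul_of_nonneg_left (hgauss t) (sq_nonneg _)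
      _ = _ := by ring
  have hball : ∀ x, ENNReal.ofReal (Real.exp (-Real.pi)) * σ (Metric.closedBall x R⁻¹) ≤
      ∫⁻ y, ENNReal.ofReal (Real.exp (-Real.pi * R ^ 2 * ‖x - y‖ ^ 2)) ∂σ := by
    intro x
    refine le_trans (mul_le_mul' le_rfl (measure_mono fun y hy => ?_))
      (mul_meas_ge_le_lintegral (by fun_prop) _)
    refine ENNReal.ofReal_le_ofReal (Real.exp_le_exp.2 ?_)
    have h1 : ‖x - y‖ ≤ R⁻¹ := by rwa [Metric.mem_closedBall, dist_comm, dist_eq_norm] at hy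
    have h2 : R ^ 2 * ‖x - y‖ ^ 2 ≤ 1 := by
      calc R ^ 2 * ‖x - y‖ ^ 2 ≤ R ^ 2 * R⁻¹ ^ 2 := by gcongr
        _ = 1 := by rw [← mul_pow, mul_inv_cancel₀ hR0.ne', one_pow]
    nlinarith [Real.pi_pos]
  have hpi : ENNReal.ofReal (Real.exp Real.pi) * ENNReal.ofReal (Real.exp (-Real.pi)) = 1 := by
    rw [← ENNReal.ofReal_mul (by positivity), ← Real.exp_add]; simp
  have hRR : ENNReal.ofReal (R ^ (-(d : ℝ))) * ENNReal.ofReal (R ^ d) = 1 := by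
    rw [← ENNReal.ofReal_mul (by positivity), ← Real.rpow_natCast, ← Real.rpow_add hR0]; simp
  calc ∫⁻ x, σ (Metric.closedBall x R⁻¹) ∂σ
      = ENNReal.ofReal (R ^ (-(d : ℝ))) * ENNReal.ofReal (Real.exp Real.pi) *
        (ENNReal.ofReal (R ^ d) *
          ∫⁻ x, ENNReal.ofReal (Real.exp (-Real.pi)) * σ (Metric.closedBall x R⁻¹) ∂σ) := by
        rw [lintegral_const_mul' _ _ ENNReal.ofReal_ne_top]
        calc _ = (ENNReal.ofReal (Real.exp Real.pi) * ENNReal.ofReal (Real.exp (-Real.pi))) *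
              (ENNReal.ofReal (R ^ (-(d : ℝ))) * ENNReal.ofReal (R ^ d)) *
              ∫⁻ x, σ (Metric.closedBall x R⁻¹) ∂σ := by rw [hpi, hRR, one_mul, one_mul]
          _ = _ := by ring
    _ ≤ ENNReal.ofReal (R ^ (-(d : ℝ))) * ENNReal.ofReal (Real.exp Real.pi) *
        (ENNReal.ofReal (Real.exp (p ^ 2) * R ^ p) * sobolevIntegral σ b) := by
        refine mul_le_mul' le_rfl (le_trans ?_ hle)
        gcongr with x
        exact hball x
    _ = _ := by
        have h7 : ENNReal.ofReal (R ^ (-b)) =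
            ENNReal.ofReal (R ^ (-(d : ℝ))) * ENNReal.ofReal (R ^ p) := by
          rw [← ENNReal.ofReal_mul (by positivity), ← Real.rpow_add hR0]
          congr 2
          rw [hp]; ring
        rw [h7, ENNReal.ofReal_mul (by positivity), ENNReal.ofReal_mul (by positivity)]
        ring

/-- The mass distribution principle for a measure whose balls centred at the points of a set of
positive measure are small. -/
lemma le_dimH_of_measure_closedBall_le {X : Type*} [MetricSpace X] [MeasurableSpace X]
    [BorelSpace X] {σ : Measure X} {A : Set X} (hA : MeasurableSet A) (hσA : σ A ≠ 0) {u : ℝ}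
    (hu : 0 ≤ u) {C : ℝ≥0∞} (hC : C ≠ ⊤)
    (h : ∀ x ∈ A, ∀ r : ℝ, 0 < r → r ≤ 1 → σ (Metric.closedBall x r) ≤ C * ENNReal.ofReal r ^ u) :
    ENNReal.ofReal u ≤ dimH A := by
  -- `C + 1` replaces `C` so that the inverse is finite and the cancellation legitimate.
  have hC1 : C + 1 ≠ ⊤ := ENNReal.add_ne_top.2 ⟨hC, ENNReal.one_ne_top⟩
  have hle : (C + 1)⁻¹ • σ.restrict A ≤ μH[u] := by
    refine Measure.le_hausdorffMeasure u _ 2⁻¹ (by simp) fun S hS => ?_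
    rw [Measure.smul_apply, smul_eq_mul, Measure.restrict_apply' hA, ENNReal.inv_mul_le_iff
      (by simp) hC1]
    rcases eq_empty_or_nonempty (S ∩ A) with h0 | ⟨x, hxS, hxA⟩
    · simp [h0]
    have hdiam : Metric.ediam S ≠ ⊤ := ne_top_of_le_ne_top (by simp) hS
    set δ := (Metric.ediam S).toReal with hδ
    have hδ1 : δ ≤ 2⁻¹ := by
      have := ENNReal.toReal_mono (by simp) hS
      simpa using this
    have hsub : S ∩ A ⊆ Metric.closedBall x δ := fun y hy => by
      rw [Metric.mem_closedBall, dist_edist]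
      exact ENNReal.toReal_mono hdiam (Metric.edist_le_ediam_of_mem hy.1 hxS)
    rw [← ENNReal.ofReal_toReal hdiam, ← hδ]
    -- The diameter `δ` may be zero while the hypothesis needs a positive radius, so radii decrease
    -- to `δ`.
    have hlim : Tendsto (fun r : ℝ => (C + 1) * ENNReal.ofReal r ^ u) (𝓝[>] δ)
        (𝓝 ((C + 1) * ENNReal.ofReal δ ^ u)) := by
      refine ENNReal.Tendsto.const_mul ?_ (Or.inr hC1)
      exact ((ENNReal.continuous_rpow_const.comp ENNReal.continuous_ofReal).tendsto δ).mono_left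
        nhdsWithin_le_nhds
    refine ge_of_tendsto hlim ?_
    filter_upwards [Ioo_mem_nhdsGT (show δ < 1 by linarith [show (2⁻¹ : ℝ) < 1 by norm_num])]
      with r hr
    have hr0 : 0 < r := lt_of_le_of_lt ENNReal.toReal_nonneg hr.1
    calc σ (S ∩ A) ≤ σ (Metric.closedBall x r) :=
          measure_mono (hsub.trans (Metric.closedBall_subset_closedBall hr.1.le))
      _ ≤ C * ENNReal.ofReal r ^ u := h x hxA r hr0 hr.2.le
      _ ≤ (C + 1) * ENNReal.ofReal r ^ u := by gcongr; exact le_self_add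
  have hne : μH[u] A ≠ 0 := by
    intro h0
    have := hle A
    rw [h0, Measure.smul_apply, smul_eq_mul, Measure.restrict_apply_self] at this
    exact mul_ne_zero (ENNReal.inv_ne_zero.2 hC1) hσA (le_antisymm this zero_le)
  refine le_dimH_of_hausdorffMeasure_ne_zero (d := u.toNNReal) ?_
  rwa [Real.coe_toNNReal _ hu]

lemma measurable_measure_closedBall {X : Type*} [PseudoMetricSpace X] [SecondCountableTopology X]
    [MeasurableSpace X] [BorelSpace X] (σ : Measure X) [SFinite σ] (r : ℝ) :
    Measurable fun x => σ (Metric.closedBall x r) := by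
  have hA : MeasurableSet {q : X × X | dist q.2 q.1 ≤ r} :=
    (isClosed_le (by fun_prop) (by fun_prop)).measurableSet
  exact measurable_measure_prodMk_left (ν := σ) hA

/-- Since `u < b`, the sum of `2^(ju) σ(B(x, 2^(-j)))` over `j` is integrable, hence finite almost
everywhere. Where it is at most `M`, balls satisfy a pointwise bound with exponent `u`; for some `M`
this happens on a part of `K` of positive mass, to which the mass distribution principle applies. -/
lemma le_dimH_of_lintegral_measure_closedBall_le {X : Type*} [MetricSpace X]
    [SecondCountableTopology X] [MeasurableSpace X] [BorelSpace X] {σ : Measure X}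
    [IsProbabilityMeasure σ] {K : Set X} (hK : MeasurableSet K) (hσK : σ Kᶜ = 0) {u b : ℝ}
    (hu : 0 ≤ u) (hub : u < b) {C : ℝ≥0∞} (hC : C ≠ ⊤)
    (h : ∀ R ≥ 1, ∫⁻ x, σ (Metric.closedBall x R⁻¹) ∂σ ≤ C * ENNReal.ofReal (R ^ (-b))) :
    ENNReal.ofReal u ≤ dimH K := by
  let g : X → ℝ≥0∞ := fun x =>
    ∑' j : ℕ, ENNReal.ofReal (((2 : ℝ) ^ j) ^ u) * σ (Metric.closedBall x ((2 : ℝ) ^ j)⁻¹)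
  have hg : Measurable g := Measurable.tsum fun j =>
    (measurable_measure_closedBall σ _).const_mul _
  have hgint : ∫⁻ x, g x ∂σ ≠ ⊤ := by
    have hq : ENNReal.ofReal (2 ^ (u - b)) < 1 := by
      rw [ENNReal.ofReal_lt_one]
      exact Real.rpow_lt_one_of_one_lt_of_neg (by norm_num) (by linarith)
    have hterm : ∀ j : ℕ, ∫⁻ x, ENNReal.ofReal (((2 : ℝ) ^ j) ^ u) *
        σ (Metric.closedBall x ((2 : ℝ) ^ j)⁻¹) ∂σ ≤ C * ENNReal.ofReal (2 ^ (u - b)) ^ j := by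
      intro j
      have hj : (0 : ℝ) < 2 ^ j := by positivity
      rw [lintegral_const_mul' _ _ ENNReal.ofReal_ne_top]
      refine (mul_le_mul' le_rfl (h _ (one_le_pow₀ (by norm_num)))).trans (le_of_eq ?_)
      rw [mul_left_comm, ← ENNReal.ofReal_mul (by positivity), ← Real.rpow_add hj,
        ← ENNReal.ofReal_pow (by positivity), ← Real.rpow_natCast, ← Real.rpow_natCast,
        ← Real.rpow_mul (by norm_num), ← Real.rpow_mul (by norm_num), mul_comm (j : ℝ),
        sub_eq_add_neg]
    refine ne_top_of_le_ne_top ?_ (le_of_eq_of_le (lintegral_tsum fun j =>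
      ((measurable_measure_closedBall σ _).const_mul _).aemeasurable)
      (ENNReal.tsum_le_tsum hterm))
    rw [ENNReal.tsum_mul_left, ENNReal.tsum_geometric]
    exact ENNReal.mul_ne_top hC (ENNReal.inv_ne_top.2 (tsub_pos_of_lt hq).ne')
  have hgfin : ∀ᵐ x ∂σ, g x < ⊤ := ae_lt_top hg hgint
  let A : ℕ → Set X := fun M => K ∩ {x | g x ≤ M}
  have hA : ∀ M, MeasurableSet (A M) := fun M => hK.inter (measurableSet_le hg measurable_const)
  obtain ⟨M, hM⟩ : ∃ M, σ (A M) ≠ 0 := by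
    by_contra! hcon
    have h1 : σ (⋃ M, A M) = 0 := measure_iUnion_null hcon
    have h2 : ∀ᵐ x ∂σ, x ∈ ⋃ M, A M := by
      have hK' : ∀ᵐ x ∂σ, x ∈ K := hσK
      filter_upwards [hgfin, hK'] with x hx hxK
      obtain ⟨M, hM⟩ := ENNReal.exists_nat_gt hx.ne
      exact mem_iUnion.2 ⟨M, hxK, hM.le⟩
    have h3 : σ univ = 0 := by
      refine measure_mono_null (t := (⋃ M, A M) ∪ (⋃ M, A M)ᶜ) (union_compl_self _).ge
        (measure_union_null h1 h2)
    simp at h3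
  refine (le_dimH_of_measure_closedBall_le (hA M) hM hu (C := M * ENNReal.ofReal (2 ^ u))
    (ENNReal.mul_ne_top (by simp) ENNReal.ofReal_ne_top) ?_).trans (dimH_mono inter_subset_left)
  rintro x ⟨-, hx⟩ r hr0 hr1
  obtain ⟨j, hj1, hj2⟩ := exists_nat_pow_near_of_lt_one hr0 hr1 (y := (2⁻¹ : ℝ))
    (by norm_num) (by norm_num)
  have hj : (0 : ℝ) < 2 ^ j := by positivity
  have h1 : ENNReal.ofReal (((2 : ℝ) ^ j) ^ u) * σ (Metric.closedBall x ((2 : ℝ) ^ j)⁻¹) ≤ M :=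
    (ENNReal.le_tsum j).trans hx
  have h2 : ENNReal.ofReal (((2 : ℝ) ^ j) ^ (-u)) * ENNReal.ofReal (((2 : ℝ) ^ j) ^ u) = 1 := by
    rw [← ENNReal.ofReal_mul (by positivity), ← Real.rpow_add hj]; simp
  calc σ (Metric.closedBall x r) ≤ σ (Metric.closedBall x ((2 : ℝ) ^ j)⁻¹) := by
        rw [← inv_pow]
        exact measure_mono (Metric.closedBall_subset_closedBall hj2)
    _ = ENNReal.ofReal (((2 : ℝ) ^ j) ^ (-u)) * (ENNReal.ofReal (((2 : ℝ) ^ j) ^ u) *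
        σ (Metric.closedBall x ((2 : ℝ) ^ j)⁻¹)) := by rw [← mul_assoc, h2, one_mul]
    _ ≤ ENNReal.ofReal (((2 : ℝ) ^ j) ^ (-u)) * M := by gcongr
    _ ≤ ENNReal.ofReal (2 ^ u * r ^ u) * M := by
        gcongr
        rw [Real.rpow_neg hj.le, ← Real.inv_rpow hj.le, ← Real.mul_rpow (by norm_num) hr0.le,
          ← inv_pow]
        refine Real.rpow_le_rpow (by positivity) ?_ hu
        rw [pow_succ] at hj1
        linarith
    _ = M * ENNReal.ofReal (2 ^ u) * ENNReal.ofReal r ^ u := by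
        rw [ENNReal.ofReal_mul (by positivity), ENNReal.ofReal_rpow_of_nonneg hr0.le hu]
        ring

end Energy

end

/-! ### Deduction of the three assertions. -/

theorem mainTheorem4 (d : ℕ) (hd : 1 ≤ d)
    (E : Set (EuclideanSpace ℝ (Fin d))) (hE : MeasurableSet E) (hEne : E.Nonempty)
    (Γ : Set (EuclideanSpace ℝ (Fin d) × ℝ)) (hΓ : MeasurableSet Γ) (hΓne : Γ.Nonempty)
    (hΓpos : Γ ⊆ dilationTranslations d) :
    ((dimH E : EReal) + (dimH Γ : EReal) - (d : EReal) ≤ sobolevDim (dilateTranslateSet Γ E)) ∧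
    (2 * (d : ENNReal) < dimH E + dimH Γ → 0 < volume (dilateTranslateSet Γ E)) ∧
    (∀ u : ℝ, 0 < u → u < d →
      (d : ENNReal) + ENNReal.ofReal u < dimH E + dimH Γ →
      ENNReal.ofReal u ≤ dimH (dilateTranslateSet Γ E)) := by
  have hEd : dimH E = ENNReal.ofReal (dimH E).toReal :=
    (ENNReal.ofReal_toReal (Real.dimH_ne_top E)).symm
  have hΓd : dimH Γ = ENNReal.ofReal (dimH Γ).toReal :=
    (ENNReal.ofReal_toReal (Real.dimH_ne_top Γ)).symm
  have hsum : dimH E + dimH Γ = ENNReal.ofReal ((dimH E).toReal + (dimH Γ).toReal) := by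
    rw [ENNReal.ofReal_add ENNReal.toReal_nonneg ENNReal.toReal_nonneg, ← hEd, ← hΓd]
  refine ⟨?_, fun h => ?_, fun u hu hud h => ?_⟩
  · have hcoe : (dimH E : EReal) + (dimH Γ : EReal) - (d : EReal) =
        (((dimH E).toReal + (dimH Γ).toReal - d : ℝ) : EReal) := by
      rw [hEd, hΓd, EReal.coe_ennreal_ofReal, EReal.coe_ennreal_ofReal,
        max_eq_left ENNReal.toReal_nonneg, max_eq_left ENNReal.toReal_nonneg,
        ENNReal.toReal_ofReal ENNReal.toReal_nonneg, ENNReal.toReal_ofReal ENNReal.toReal_nonneg]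
      push_cast
      rfl
    rw [hcoe]
    refine EReal.ge_of_forall_gt_iff_ge.1 fun a ha => ?_
    obtain ⟨σ, hσ, hσa⟩ := exists_isCarriedBy_sobolevIntegral_lt_top hE hEne hΓ hΓne
      (EReal.coe_lt_coe_iff.1 ha)
    exact (le_iSup₂ (f := fun (s : ℝ) (_ : sobolevIntegral σ s < ⊤) => (s : EReal)) a hσa).trans
      (le_iSup₂ (f := fun (μ : Measure (EuclideanSpace ℝ (Fin d)))
        (_ : IsCarriedBy μ (dilateTranslateSet Γ E)) => measureSobolevDim μ) σ hσ)
  -- The exponent `a = d` is admissible, and there the weight `(1 + ‖ξ‖)^(a - d)` is identically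
  -- one.
  · have h' : (d : ℝ) < (dimH E).toReal + (dimH Γ).toReal - d := by
      rw [hsum, ENNReal.lt_ofReal_iff_toReal_lt (by finiteness)] at h
      simp at h
      linarith
    obtain ⟨σ, ⟨hσp, K, hK, hKΓ, hσK⟩, hσ⟩ :=
      exists_isCarriedBy_sobolevIntegral_lt_top hE hEne hΓ hΓne h'
    refine lt_of_lt_of_le ?_ (measure_mono hKΓ)
    refine volume_pos_of_lintegral_norm_sq_measureFourier_lt_top hK hσK ?_
    simpa [sobolevIntegral] using hσ
  · have h' : u < (dimH E).toReal + (dimH Γ).toReal - d := by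
      rw [hsum, ENNReal.lt_ofReal_iff_toReal_lt (by finiteness),
        ENNReal.toReal_add (by finiteness) (by finiteness), ENNReal.toReal_ofReal hu.le] at h
      simp at h
      linarith
    -- The exponent `b` must exceed `u` for the series of ball masses to converge, and stay at most
    -- `d` for the Gaussian comparison.
    obtain ⟨b, hub, hb⟩ := exists_between (lt_min hud h')
    obtain ⟨σ, ⟨hσp, K, hK, hKΓ, hσK⟩, hσ⟩ :=
      exists_isCarriedBy_sobolevIntegral_lt_top hE hEne hΓ hΓne (hb.trans_le (min_le_right _ _))
    obtain ⟨C, hC, hball⟩ := exists_lintegral_measure_closedBall_le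
      (hb.le.trans (min_le_left _ _)) hσ
    exact (le_dimH_of_lintegral_measure_closedBall_le hK.measurableSet hσK hu.le hub hC
      hball).trans (dimH_mono hKΓ)
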